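/- Let $M$ be a smooth $4$-manifold with a smooth coframe $\{\theta_1,\theta_2,\theta_3,\theta_4\}$ and dual frame $\{E_1,E_2,E_3,E_4\}$, and let $\alpha,\phi:M\to\mathbb R$ be smooth functions such that $a=\alpha\cos\phi$ and $b=\alpha\sin\phi$ vanish nowhere. Suppose that, writing $E_i\ln f$ for $E_i(\ln|f|)$, the following structure equations hold: $$\begin{aligned} d\theta_1&=-\tfrac12 b\,\theta_1\wedge\theta_2+E_4(\ln a)\,\theta_2\wedge\theta_3-E_3(\ln a)\,\theta_1\wedge\theta_3+\left(\tfrac32 b+E_2(\ln a)\right)\theta_3\wedge\theta_4,\\ d\theta_2&=\tfrac12 a\,\theta_1\wedge\theta_2+E_3(\ln b)\,\theta_1\wedge\theta_4-E_4(\ln b)\,\theta_2\wedge\theta_4-\left(\tfrac32 a+E_1(\ln b)\right)\theta_3\wedge\theta_4,\\ d\theta_3&=\tfrac12 b\,\theta_2\wedge\theta_3+E_4(\ln a)\,\theta_1\wedge\theta_2+a\,\theta_2\wedge\theta_4+\left(\tfrac32 b+E_2(\ln a)\right)\theta_4\wedge\theta_1+\left(a+E_1(\ln a)\right)\theta_1\wedge\theta_3,\\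 d\theta_4&=b\,\theta_1\wedge\theta_3-E_3(\ln b)\,\theta_1\wedge\theta_2+\tfrac12 a\,\theta_1\wedge\theta_4+\left(\tfrac32 a+E_1(\ln b)\right)\theta_3\wedge\theta_2+\left(b+E_2(\ln b)\right)\theta_2\wedge\theta_4 . \end{aligned}$$ Let $g=\sum_i\theta_i\otimes\theta_i$, and let $J,I$ be the endomorphism fields with $g(J\cdot,\cdot)=\omega_J=\theta_1\wedge\theta_3+\theta_2\wedge\theta_4$ and $g(I\cdot,\cdot)=\omega_I=-\theta_1\wedge\theta_3+\theta_2\wedge\theta_4$. Then: 1. $(M,g,J)$ is a Kähler surface, and both $J$ and $I$ are Hermitian (orthogonal and integrable). 2. The Ricci form of $(M,g,J)$ is $\rho=d\left(d^I\ln|\tan\phi|\right)$, where $d^If=-df\circ I$ and $\rho(X,Y)=\mathrm{Ric}(X,JY)$ (with the opposite convention $\rho(X,Y)=\mathrm{Ric}(JX,Y)$ the sign changes). It is $J$- and $I$-invariant. 3. $(M,g,J)$ is a QCH Kähler surface of generalized orthotoric type with opposite Hermitian structure $I$. That is, there is a smooth $J$-invariant distribution $\mathcal D$ of rank $2$ such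 that $g(R(X,JX)JX,X)$, for unit $X\in T_xM$, depends only on $x$ and on the length of the orthogonal projection of $X$ to $\mathcal D$; moreover $I=-J$ on $\mathcal D$ and $I=J$ on $\mathcal D^\perp$, and the surface is nowhere of generalized Calabi type: neither $\mathcal D$ nor $\mathcal D^\perp$ is integrable on any nonempty open set, and at every point $I$ is not parallel and neither $\mathcal D$ nor $\mathcal D^\perp$ equals the nullity $\{v:\nabla_vI=0\}$. 4. There is exactly one smooth $1$-form $\theta$ with $d\omega_I=2\,\theta\wedge\omega_I$ (the Lee form of $(M,g,I)$), and $$\begin{aligned}d\theta={}&\left(E_2(\alpha\cos\phi)-E_1(\alpha\sin\phi)\right)(\theta_2\wedge\theta_1+\theta_3\wedge\theta_4)\\&+\left(E_4(\alpha\sin\phi)+E_3(\alpha\cos\phi)\right)(\theta_4\wedge\theta_2+\theta_3\wedge\theta_1)\\&+\left(E_3(\alpha\sin\phi)-E_4(\alpha\cos\phi)\right)(\theta_3\wedge\theta_2+\theta_1\wedge\theta_4).\end{aligned}$$ -/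

import Mathlib

open scoped Manifold ContDiff Topology Bundle

/-! Vector fields, tensor fields and exterior derivatives on a smooth 4-manifold `M`
(modelled on `ℝ⁴`, without boundary). -/

/-- A (not necessarily smooth) vector field. -/
abbrev VField (M : Type*) [TopologicalSpace M] [ChartedSpace (EuclideanSpace ℝ (Fin 4)) M] :=
  Π x : M, TangentSpace (𝓡 4) x

/-- A (not necessarily smooth) 1-form. -/
abbrev OneForm (M : Type*) [TopologicalSpace M] [ChartedSpace (EuclideanSpace ℝ (Fin 4)) M] :=
  Π x : M, TangentSpace (𝓡 4) x →L[ℝ] ℝ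

/-- A field of bilinear forms; 2-forms are the alternating ones among them. -/
abbrev BilinField (M : Type*) [TopologicalSpace M]
    [ChartedSpace (EuclideanSpace ℝ (Fin 4)) M] :=
  Π x : M, TangentSpace (𝓡 4) x →L[ℝ] TangentSpace (𝓡 4) x →L[ℝ] ℝ

/-- A field of endomorphisms of the tangent bundle. -/
abbrev EndField (M : Type*) [TopologicalSpace M] [ChartedSpace (EuclideanSpace ℝ (Fin 4)) M] :=
  Π x : M, TangentSpace (𝓡 4) x →L[ℝ] TangentSpace (𝓡 4) x

/-- A tensor field of type (1,3): `R x u v w` is `R(u,v)w`. -/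
abbrev CurvField (M : Type*) [TopologicalSpace M] [ChartedSpace (EuclideanSpace ℝ (Fin 4)) M] :=
  Π x : M, TangentSpace (𝓡 4) x →ₗ[ℝ] TangentSpace (𝓡 4) x →ₗ[ℝ]
    TangentSpace (𝓡 4) x →ₗ[ℝ] TangentSpace (𝓡 4) x

/-- A field of subspaces of the tangent spaces. -/
abbrev SubspaceField (M : Type*) [TopologicalSpace M]
    [ChartedSpace (EuclideanSpace ℝ (Fin 4)) M] :=
  Π x : M, Submodule ℝ (TangentSpace (𝓡 4) x)

noncomputable section

section Forms

variable {M : Type*} [TopologicalSpace M] [ChartedSpace (EuclideanSpace ℝ (Fin 4)) M]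

/-- The vector field `X` is smooth on the set `U`. -/
def SmoothFieldOn [IsManifold (𝓡 4) ∞ M] (X : VField M) (U : Set M) : Prop :=
  ContMDiffOn (𝓡 4) (𝓡 4).tangent ∞ (fun x => (X x : TangentBundle (𝓡 4) M)) U

/-- `X` is a smooth vector field. -/
def SmoothField [IsManifold (𝓡 4) ∞ M] (X : VField M) : Prop :=
  ContMDiff (𝓡 4) (𝓡 4).tangent ∞ (fun x => (X x : TangentBundle (𝓡 4) M))

/-- `θ` is a smooth 1-form, i.e. a smooth section of the cotangent bundle. -/
def SmoothOneForm [IsManifold (𝓡 4) ∞ M] (θ : OneForm M) : Prop :=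
  ContMDiff (𝓡 4) ((𝓡 4).prod 𝓘(ℝ, EuclideanSpace ℝ (Fin 4) →L[ℝ] ℝ)) ∞
    (fun x => Bundle.TotalSpace.mk' (EuclideanSpace ℝ (Fin 4) →L[ℝ] ℝ)
      (E := fun y : M => TangentSpace (𝓡 4) y →L[ℝ] Bundle.Trivial M ℝ y) x (θ x))

/-- The derivative `X f` of a function along a vector field. -/
def dirD (X : VField M) (f : M → ℝ) (x : M) : ℝ := mvfderiv (𝓡 4) f x (X x)

/-- `(a ∧ b)(u,v) = a(u) b(v) - b(u) a(v)`. -/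
def wedge (a b : OneForm M) : BilinField M :=
  fun x => (a x).smulRight (b x) - (b x).smulRight (a x)

/-- `(a ∧ η)(u,v,w) = a(u) η(v,w) + a(v) η(w,u) + a(w) η(u,v)` for a 2-form `η`. -/
def wedgeTwo (a : OneForm M) (η : BilinField M) (x : M) (u v w : TangentSpace (𝓡 4) x) : ℝ :=
  a x u * η x v w + a x v * η x w u + a x w * η x u v

/-- `dθ(X,Y) = X(θ(Y)) - Y(θ(X)) - θ([X,Y])` for a 1-form `θ`. -/
def dOne (θ : OneForm M) (X Y : VField M) (x : M) : ℝ :=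
  dirD X (fun y => θ y (Y y)) x - dirD Y (fun y => θ y (X y)) x
    - θ x (VectorField.mlieBracket (𝓡 4) X Y x)

/-- `dη(X,Y,Z)` is the cyclic sum of `X(η(Y,Z)) - η([X,Y],Z)` for a 2-form `η`. -/
def dTwo (η : BilinField M) (X Y Z : VField M) (x : M) : ℝ :=
  dirD X (fun y => η y (Y y) (Z y)) x + dirD Y (fun y => η y (Z y) (X y)) x
    + dirD Z (fun y => η y (X y) (Y y)) x
    - η x (VectorField.mlieBracket (𝓡 4) X Y x) (Z x)
    - η x (VectorField.mlieBracket (𝓡 4) Y Z x) (X x)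
    - η x (VectorField.mlieBracket (𝓡 4) Z X x) (Y x)

/-- The 2-form `η` is the exterior derivative of the 1-form `θ`. -/
def IsExtDerivOne [IsManifold (𝓡 4) ∞ M] (θ : OneForm M) (η : BilinField M) : Prop :=
  ∀ X Y : VField M, SmoothField X → SmoothField Y →
    ∀ x, η x (X x) (Y x) = dOne θ X Y x

/-- The 2-form `η` is closed. -/
def IsClosedTwo [IsManifold (𝓡 4) ∞ M] (η : BilinField M) : Prop :=
  ∀ X Y Z : VField M, SmoothField X → SmoothField Y → SmoothField Z →
    ∀ x, dTwo η X Y Z x = 0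

/-- The 1-form `d^I f = I df = - df ∘ I`. -/
def dTwist (I : EndField M) (f : M → ℝ) : OneForm M :=
  fun x => -((mvfderiv (𝓡 4) f x).comp (I x))

/-- `θ 0, …, θ 3` is a smooth coframe with dual frame `E 0, …, E 3`. (For a dual pair,
smoothness of the coframe and smoothness of the frame are equivalent.) -/
structure IsDualCoframe [IsManifold (𝓡 4) ∞ M] (θ : Fin 4 → OneForm M) (E : Fin 4 → VField M) :
    Prop where
  smooth_coframe : ∀ i, SmoothOneForm (θ i)
  smooth_frame : ∀ i, SmoothField (E i)
  dual : ∀ i j x, θ i x (E j x) = if i = j then 1 else 0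

end Forms

section Structure

variable {M : Type*} [TopologicalSpace M] [ChartedSpace (EuclideanSpace ℝ (Fin 4)) M]

/-- The logarithmic derivative `X (ln |f|)`. -/
def logD (X : VField M) (f : M → ℝ) (x : M) : ℝ := dirD X (fun y => Real.log |f y|) x

/-- The structure equations of the coframe `θ 0, …, θ 3` with dual frame `E 0, …, E 3`; here
`a = α cos φ` and `b = α sin φ`. -/
structure StructureEquations [IsManifold (𝓡 4) ∞ M] (θ : Fin 4 → OneForm M)
    (E : Fin 4 → VField M) (a b : M → ℝ) : Prop where
  d_one : IsExtDerivOne (θ 0) fun x =>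
    (-(1 / 2) * b x) • wedge (θ 0) (θ 1) x + logD (E 3) a x • wedge (θ 1) (θ 2) x
      - logD (E 2) a x • wedge (θ 0) (θ 2) x + (3 / 2 * b x + logD (E 1) a x) • wedge (θ 2) (θ 3) x
  d_two : IsExtDerivOne (θ 1) fun x =>
    (1 / 2 * a x) • wedge (θ 0) (θ 1) x + logD (E 2) b x • wedge (θ 0) (θ 3) x
      - logD (E 3) b x • wedge (θ 1) (θ 3) x - (3 / 2 * a x + logD (E 0) b x) • wedge (θ 2) (θ 3) x
  d_three : IsExtDerivOne (θ 2) fun x =>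
    (1 / 2 * b x) • wedge (θ 1) (θ 2) x + logD (E 3) a x • wedge (θ 0) (θ 1) x
      + a x • wedge (θ 1) (θ 3) x + (3 / 2 * b x + logD (E 1) a x) • wedge (θ 3) (θ 0) x
      + (a x + logD (E 0) a x) • wedge (θ 0) (θ 2) x
  d_four : IsExtDerivOne (θ 3) fun x =>
    b x • wedge (θ 0) (θ 2) x - logD (E 2) b x • wedge (θ 0) (θ 1) x
      + (1 / 2 * a x) • wedge (θ 0) (θ 3) x + (3 / 2 * a x + logD (E 0) b x) • wedge (θ 2) (θ 1) x
      + (b x + logD (E 1) b x) • wedge (θ 1) (θ 3) x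

end Structure

section Riemannian

variable {M : Type*} [TopologicalSpace M] [ChartedSpace (EuclideanSpace ℝ (Fin 4)) M]
  [IsManifold (𝓡 4) ∞ M]

/-- Smooth Riemannian metrics on `M`. -/
abbrev Metric4 (M : Type*) [TopologicalSpace M] [ChartedSpace (EuclideanSpace ℝ (Fin 4)) M]
    [IsManifold (𝓡 4) ∞ M] :=
  Bundle.ContMDiffRiemannianMetric (𝓡 4) ∞ (EuclideanSpace ℝ (Fin 4))
    (fun x : M => TangentSpace (𝓡 4) x)

/-- Affine connections on `M`; `nab Y x v` is `∇_v Y`. -/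
abbrev Connection4 (M : Type*) [TopologicalSpace M]
    [ChartedSpace (EuclideanSpace ℝ (Fin 4)) M] [IsManifold (𝓡 4) ∞ M] :=
  CovariantDerivative (𝓡 4) (EuclideanSpace ℝ (Fin 4)) (fun x : M => TangentSpace (𝓡 4) x)

/-- The vector field `∇_X Y`. -/
def covD (nab : Connection4 M) (X Y : VField M) : VField M := fun x => nab Y x (X x)

/-- `nab` is the Levi-Civita connection of `g`: torsion free and metric. -/
structure IsLeviCivita (g : Metric4 M) (nab : Connection4 M) : Prop where
  torsion_free : nab.torsion = 0
  metric : ∀ (X Y : VField M) (x : M),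
    MDifferentiableAt (𝓡 4) (𝓡 4).tangent (fun y => (X y : TangentBundle (𝓡 4) M)) x →
    MDifferentiableAt (𝓡 4) (𝓡 4).tangent (fun y => (Y y : TangentBundle (𝓡 4) M)) x →
    ∀ v : TangentSpace (𝓡 4) x,
      mvfderiv (𝓡 4) (fun y => g.inner y (X y) (Y y)) x v
        = g.inner x (nab X x v) (Y x) + g.inner x (X x) (nab Y x v)

/-- `R` is the Riemann curvature tensor of `g`, with
`R(X,Y)Z = ∇_X ∇_Y Z - ∇_Y ∇_X Z - ∇_[X,Y] Z`. -/
def IsRiemannCurvature (g : Metric4 M) (R : CurvField M) : Prop :=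
  ∃ nab : Connection4 M, IsLeviCivita g nab ∧
    ∀ X Y Z : VField M, SmoothField X → SmoothField Y → SmoothField Z → ∀ x,
      R x (X x) (Y x) (Z x) =
        covD nab X (covD nab Y Z) x - covD nab Y (covD nab X Z) x
          - covD nab (VectorField.mlieBracket (𝓡 4) X Y) Z x

/-- The Ricci tensor `Ric(u,v) = tr (w ↦ R(w,u)v)`. -/
def ricci (R : CurvField M) (x : M) (u v : TangentSpace (𝓡 4) x) : ℝ :=
  LinearMap.trace ℝ (TangentSpace (𝓡 4) x) (((R x).flip u).flip v)

/-- The Ricci form `ρ(u,v) = Ric(u, J v)`. -/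
def ricciForm (R : CurvField M) (J : EndField M) (x : M) (u v : TangentSpace (𝓡 4) x) : ℝ :=
  ricci R x u (J x v)

/-- The fundamental form `ω_J(u,v) = g(J u, v)`. -/
def fundamentalForm (g : Metric4 M) (J : EndField M) : BilinField M :=
  fun x => (g.inner x).comp (J x)

/-- `(M,g,J)` is a Hermitian surface: `J` is a smooth `g`-orthogonal almost complex structure
with vanishing Nijenhuis tensor. -/
structure IsHermitian (g : Metric4 M) (J : EndField M) : Prop where
  smooth : ∀ X : VField M, SmoothField X → SmoothField (fun x => J x (X x))
  sq : ∀ x v, J x (J x v) = -v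
  orthogonal : ∀ x u v, g.inner x (J x u) (J x v) = g.inner x u v
  nijenhuis : ∀ X Y : VField M, SmoothField X → SmoothField Y → ∀ x,
    VectorField.mlieBracket (𝓡 4) (fun y => J y (X y)) (fun y => J y (Y y)) x
      - J x (VectorField.mlieBracket (𝓡 4) (fun y => J y (X y)) Y x)
      - J x (VectorField.mlieBracket (𝓡 4) X (fun y => J y (Y y)) x)
      - VectorField.mlieBracket (𝓡 4) X Y x = 0

/-- `(M,g,J)` is a Kähler surface: Hermitian with closed fundamental form. -/
structure IsKahler (g : Metric4 M) (J : EndField M) : Prop where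
  hermitian : IsHermitian g J
  closed : IsClosedTwo (fundamentalForm g J)

/-- `lee` is a Lee form of `(M,g,I)`: a smooth 1-form with `dω_I = 2 lee ∧ ω_I`. -/
structure IsLeeForm (g : Metric4 M) (I : EndField M) (lee : OneForm M) : Prop where
  smooth : SmoothOneForm lee
  eq : ∀ X Y Z : VField M, SmoothField X → SmoothField Y → SmoothField Z → ∀ x,
    dTwo (fundamentalForm g I) X Y Z x
      = 2 * wedgeTwo lee (fundamentalForm g I) x (X x) (Y x) (Z x)

/-- `D` is a smooth distribution of rank 2. -/
structure IsPlaneField (D : SubspaceField M) : Prop where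
  rank : ∀ x, Module.finrank ℝ (D x) = 2
  smooth : ∀ x, ∃ U : Set M, IsOpen U ∧ x ∈ U ∧ ∃ s : Fin 2 → VField M,
    (∀ i, SmoothFieldOn (s i) U) ∧
    ∀ y ∈ U, D y = Submodule.span ℝ (Set.range fun i => s i y)

/-- The orthogonal complement of `D`. -/
def perp (g : Metric4 M) (D : SubspaceField M) : SubspaceField M := fun x =>
  { carrier := {v | ∀ w ∈ D x, g.inner x w v = 0}
    add_mem' := by
      intro u v hu hv w hw
      simp [hu w hw, hv w hw]
    zero_mem' := by
      intro w _
      simp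
    smul_mem' := by
      intro c v hv w hw
      simp [hv w hw] }

/-- `D` is integrable (involutive) on the open set `U`. -/
def IsIntegrableOn (D : SubspaceField M) (U : Set M) : Prop :=
  ∀ X Y : VField M, SmoothFieldOn X U → SmoothFieldOn Y U →
    (∀ x ∈ U, X x ∈ D x) → (∀ x ∈ U, Y x ∈ D x) →
    ∀ x ∈ U, VectorField.mlieBracket (𝓡 4) X Y x ∈ D x

/-- `D` is integrable on no nonempty open set. -/
def IsNowhereIntegrable (D : SubspaceField M) : Prop :=
  ∀ U : Set M, IsOpen U → U.Nonempty → ¬ IsIntegrableOn D U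

/-- The nullity of `I` for the connection `nab`: at `x`, all `v` with `∇_v I = 0`, that is
`∇_v (I X) = I (∇_v X)` for all smooth `X`. -/
def nullity (nab : Connection4 M) (I : EndField M) : SubspaceField M := fun x =>
  { carrier := {v | ∀ X : VField M, SmoothField X →
      nab (fun y => I y (X y)) x v = I x (nab X x v)}
    add_mem' := by
      intro u v hu hv X hX
      simp [hu X hX, hv X hX]
    zero_mem' := by
      intro X _
      simp
    smul_mem' := by
      intro c v hv X hX
      simp [hv X hX] }

/-- `(M,g,J)` is a QCH Kähler surface with respect to the distribution `D`: `D` is a `J`-invariant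
plane field, and the holomorphic curvature `g(R(X,JX)JX,X)` of a unit vector `X` depends only on
the base point and on the length of the orthogonal projection of `X` to `D`. -/
structure IsQCH (g : Metric4 M) (J : EndField M) (D : SubspaceField M) : Prop where
  kahler : IsKahler g J
  plane : IsPlaneField D
  invariant : ∀ x, ∀ v ∈ D x, J x v ∈ D x
  curvature : ∃ R : CurvField M, IsRiemannCurvature g R ∧
    ∀ (x : M) (v v' w w' : TangentSpace (𝓡 4) x),
      v ∈ D x → w ∈ D x → v' ∈ perp g D x → w' ∈ perp g D x →
      g.inner x (v + v') (v + v') = 1 → g.inner x (w + w') (w + w') = 1 →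
      g.inner x v v = g.inner x w w →
      g.inner x (R x (v + v') (J x (v + v')) (J x (v + v'))) (v + v')
        = g.inner x (R x (w + w') (J x (w + w')) (J x (w + w'))) (w + w')

/-- `(M,g,J)` is a QCH Kähler surface of generalized orthotoric type with opposite Hermitian
structure `I`: for some distribution `D` as in the definition of QCH, `I` is the Hermitian
structure equal to `-J` on `D` and to `J` on the orthogonal complement of `D`, and the surface is
nowhere of generalized Calabi type: neither `D` nor its complement is integrable on any nonempty
open set, and at every point `I` is not parallel and neither `D` nor its complement is the nullity
of `I`. -/
structure IsGeneralizedOrthotoric (g : Metric4 M) (J I : EndField M) : Prop where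
  hermitian : IsHermitian g I
  exists_plane : ∃ D : SubspaceField M, IsQCH g J D ∧
    (∀ x, ∀ v ∈ D x, I x v = -J x v) ∧ (∀ x, ∀ v ∈ perp g D x, I x v = J x v) ∧
    IsNowhereIntegrable D ∧ IsNowhereIntegrable (perp g D) ∧
    ∃ nab : Connection4 M, IsLeviCivita g nab ∧
      ∀ x, nullity nab I x ≠ ⊤ ∧ D x ≠ nullity nab I x ∧ perp g D x ≠ nullity nab I x

end Riemannian

end

/-!
All indices run from `0` to `3`, and `Γ i j k = g(∇_{E_i} E_j, E_k)`, `ω_jk = ∑ i, Γ i j k • θ_i`.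

The structure equations determine the Levi-Civita connection of `g`, since the torsion-free metric
connection can be read off from `dθ_i`. The outcome (`StructureEquations.isConnectionCoeff`) is that
`ω_01 = ω_23 = (-b θ_0 + a θ_1) / 2` and `ω_03 = ω_12 = (b θ_2 + a θ_3) / 2`: the connection takes
values in the centralizer `u(2)` of `J`, while `ω_02` and `ω_13` involve logarithmic derivatives of
`a` and `b`. That `J` is Kähler, that `I` is integrable and that the Lee form of `I` is
`a θ_0 + b θ_1` are direct consequences of the structure equations.

The curvature forms `Ω_01 = Ω_23` and `Ω_03 = Ω_12` contain only first derivatives of `a` and `b`.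
The pair symmetry `R(E_0, E_1, E_0, E_3) = R(E_0, E_3, E_0, E_1)` of the curvature forces
`E_2 a = E_3 b` (`IsAdapted.compat`), and with this relation
`Ω_01 = μ (θ_0 ∧ θ_1 + θ_2 ∧ θ_3)` and `Ω_03 = μ (θ_0 ∧ θ_3 + θ_1 ∧ θ_2)` for one function `μ`. No
second derivatives of `a` and `b` need to be compared after that: the first Bianchi identity, which
is the Jacobi identity of the frame, yields `Ω_02 = κ θ_0 ∧ θ_2 + 2 μ θ_1 ∧ θ_3` and
`Ω_13 = 2 μ θ_0 ∧ θ_2 + κ' θ_1 ∧ θ_3` (`IsAdapted.curvature_eq`). The conclusions follow.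

* The Ricci form is `Ω_02 + Ω_13`, visibly invariant under `J` and `I`. It is the exterior
  derivative of `ω_02 + ω_13`, because `u(2) → u(1)` kills commutators, and comparing coefficients
  gives `ω_02 + ω_13 = d^I (ln |b| - ln |a|) = d^I ln |tan φ|` (`IsAdapted.ricciForm_eq_dOne`).
* Let `D` be the span of `E_0` and `E_2`. The holomorphic curvature of `v` is a polynomial in the
  squared lengths of the components of `v` in `D` and its complement, which is the QCH condition
  (`IsAdapted.holomorphic_curvature`).
* The component of `[E_0, E_2]` along `E_3` is `-b` and that of `[E_1, E_3]` along `E_2` is `-a`, so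
  neither distribution is integrable anywhere. The nullity of `I` is contained in the kernel of
  `ω_01`, which contains neither `E_0` nor `E_1`, as `a` and `b` do not vanish
  (`IsAdapted.isGeneralizedOrthotoric`).
* The formula for the derivative of the Lee form is the structure equations together with
  `E_2 a = E_3 b` (`IsAdapted.dOne_leeForm`).

Brackets with fields `f Z`, where `Z` is nowhere zero, give two facts about derivatives of
functions: the Leibniz rule shows that `X f` is smooth (`IsDualCoframe.smooth_dirD`), and the Jacobi
identity that `X Y f - Y X f = [X, Y] f` (`IsDualCoframe.dirD_commutator`).
-/

/-! ### Directional derivatives, smooth fields and Lie brackets -/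

section Calculus

variable {M : Type*} [TopologicalSpace M] [ChartedSpace (EuclideanSpace ℝ (Fin 4)) M]

/-- `f` is a smooth real-valued function. -/
abbrev SmoothFun (f : M → ℝ) : Prop := ContMDiff (𝓡 4) 𝓘(ℝ, ℝ) ∞ f

/-- `f` is differentiable at `x`. -/
abbrev DiffFunAt (f : M → ℝ) (x : M) : Prop := MDifferentiableAt (𝓡 4) 𝓘(ℝ, ℝ) f x

/-- The vector field `X` is differentiable at `x`. -/
abbrev DiffFieldAt [IsManifold (𝓡 4) ∞ M] (X : VField M) (x : M) : Prop :=
  MDifferentiableAt (𝓡 4) (𝓡 4).tangent (fun y => (X y : TangentBundle (𝓡 4) M)) x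

theorem SmoothFun.diffAt {f : M → ℝ} (hf : SmoothFun f) (x : M) : DiffFunAt f x :=
  (hf x).mdifferentiableAt (by simp)

theorem dirD_const (X : VField M) (r : ℝ) (x : M) : dirD X (fun _ => r) x = 0 := by
  simp [dirD, mvfderiv_const]

theorem dirD_add (X : VField M) {f h : M → ℝ} {x : M} (hf : DiffFunAt f x)
    (hh : DiffFunAt h x) : dirD X (fun y => f y + h y) x = dirD X f x + dirD X h x := by
  exact congrArg (fun l => l (X x)) (mvfderiv_add hf hh)

theorem dirD_sub (X : VField M) {f h : M → ℝ} {x : M} (hf : DiffFunAt f x)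
    (hh : DiffFunAt h x) : dirD X (fun y => f y - h y) x = dirD X f x - dirD X h x := by
  exact congrArg (fun l => l (X x)) (mvfderiv_sub hf hh)

theorem dirD_neg (X : VField M) (f : M → ℝ) (x : M) :
    dirD X (fun y => -f y) x = -dirD X f x := by
  exact congrArg (fun l => l (X x)) (mvfderiv_neg (I := 𝓡 4) (g := f) (x := x))

theorem dirD_mul (X : VField M) {f h : M → ℝ} {x : M} (hf : DiffFunAt f x)
    (hh : DiffFunAt h x) :
    dirD X (fun y => f y * h y) x = f x * dirD X h x + dirD X f x * h x := by
  have := mvfderiv_mul hf hh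
  have := congrArg (fun l => l (X x)) this
  simp only [dirD]
  refine this.trans ?_
  simp
  ring

theorem DiffFunAt.add {f h : M → ℝ} {x : M} (hf : DiffFunAt f x) (hh : DiffFunAt h x) :
    DiffFunAt (fun y => f y + h y) x := MDifferentiableAt.add hf hh

theorem DiffFunAt.mul {f h : M → ℝ} {x : M} (hf : DiffFunAt f x) (hh : DiffFunAt h x) :
    DiffFunAt (fun y => f y * h y) x := MDifferentiableAt.mul hf hh

theorem dirD_sum (X : VField M) {f : Fin 4 → M → ℝ} {x : M} (hf : ∀ i, DiffFunAt (f i) x) :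
    dirD X (fun y => ∑ i, f i y) x = ∑ i, dirD X (f i) x := by
  simp only [Fin.sum_univ_four]
  have h1 := DiffFunAt.add (hf 0) (hf 1)
  have h2 := DiffFunAt.add h1 (hf 2)
  rw [dirD_add X h2 (hf 3), dirD_add X h1 (hf 2), dirD_add X (hf 0) (hf 1)]

theorem SmoothFun.add {f h : M → ℝ} (hf : SmoothFun f) (hh : SmoothFun h) :
    SmoothFun fun y => f y + h y := ContMDiff.add hf hh

theorem SmoothFun.mul {f h : M → ℝ} (hf : SmoothFun f) (hh : SmoothFun h) :
    SmoothFun fun y => f y * h y := ContMDiff.mul hf hh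

theorem SmoothFun.sub {f h : M → ℝ} (hf : SmoothFun f) (hh : SmoothFun h) :
    SmoothFun fun y => f y - h y := ContMDiff.sub hf hh

theorem SmoothFun.neg {f : M → ℝ} (hf : SmoothFun f) : SmoothFun fun y => -f y :=
  ContMDiff.neg hf

theorem SmoothFun.const (r : ℝ) : SmoothFun fun _ : M => r := contMDiff_const

theorem SmoothFun.sum {f : Fin 4 → M → ℝ} (hf : ∀ i, SmoothFun (f i)) :
    SmoothFun fun y => ∑ i, f i y := by
  simp only [Fin.sum_univ_four]
  exact (((hf 0).add (hf 1)).add (hf 2)).add (hf 3)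

variable [IsManifold (𝓡 4) ∞ M]

theorem isManifold_minSmoothness_two : IsManifold (𝓡 4) (minSmoothness ℝ 2) M := by
  rw [minSmoothness_of_isRCLikeNormedField]
  infer_instance

theorem isManifold_minSmoothness_three : IsManifold (𝓡 4) (minSmoothness ℝ 3) M := by
  rw [minSmoothness_of_isRCLikeNormedField]
  exact IsManifold.of_le (n := ∞) (WithTop.coe_le_coe.2 (le_top (a := (3 : ℕ∞))))

attribute [local instance] isManifold_minSmoothness_two isManifold_minSmoothness_three

theorem SmoothField.diffAt {X : VField M} (hX : SmoothField X) (x : M) : DiffFieldAt X x :=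
  (hX x).mdifferentiableAt (by simp)

theorem SmoothField.add {X Y : VField M} (hX : SmoothField X) (hY : SmoothField Y) :
    SmoothField fun y => X y + Y y := ContMDiff.add_section hX hY

theorem SmoothField.smul {f : M → ℝ} {X : VField M} (hf : SmoothFun f) (hX : SmoothField X) :
    SmoothField fun y => f y • X y := ContMDiff.smul_section hf hX

theorem SmoothField.sum {X : Fin 4 → VField M} (hX : ∀ i, SmoothField (X i)) :
    SmoothField fun y => ∑ i, X i y := by
  simp only [Fin.sum_univ_four]
  exact (((hX 0).add (hX 1)).add (hX 2)).add (hX 3)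

theorem SmoothField.bracket {X Y : VField M} (hX : SmoothField X) (hY : SmoothField Y) :
    SmoothField (VectorField.mlieBracket (𝓡 4) X Y) :=
  haveI : IsManifold (𝓡 4) (((⊤ : ℕ∞) : WithTop ℕ∞) + 1) M := by simpa using! ‹IsManifold (𝓡 4) ∞ M›
  ContDiff.mlieBracket_vectorField (n := ⊤) (m := ⊤) (𝕜 := ℝ) (I := 𝓡 4) hX hY (by simp)

theorem DiffFieldAt.add {X Y : VField M} {x : M} (hX : DiffFieldAt X x)
    (hY : DiffFieldAt Y x) : DiffFieldAt (fun y => X y + Y y) x :=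
  mdifferentiableAt_add_section hX hY

theorem DiffFieldAt.smul {f : M → ℝ} {X : VField M} {x : M} (hf : DiffFunAt f x)
    (hX : DiffFieldAt X x) : DiffFieldAt (fun y => f y • X y) x :=
  MDifferentiableAt.smul_section hf hX

theorem SmoothOneForm.apply {τ : OneForm M} {X : VField M} (hτ : SmoothOneForm τ)
    (hX : SmoothField X) : SmoothFun fun y => τ y (X y) := by
  have : ContMDiff (𝓡 4) ((𝓡 4).prod 𝓘(ℝ)) ∞
      (fun m => Bundle.TotalSpace.mk' ℝ (E := Bundle.Trivial M ℝ) m (τ m (X m))) :=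
    ContMDiff.clm_bundle_apply hτ hX
  intro x
  have h := this x
  rw [Bundle.contMDiffAt_totalSpace] at h
  exact h.2

theorem SmoothOneForm.diff_apply {τ : OneForm M} {X : VField M} {x : M}
    (hτ : SmoothOneForm τ) (hX : DiffFieldAt X x) : DiffFunAt (fun y => τ y (X y)) x := by
  have : MDifferentiableAt (𝓡 4) ((𝓡 4).prod 𝓘(ℝ))
      (fun m => Bundle.TotalSpace.mk' ℝ (E := Bundle.Trivial M ℝ) m (τ m (X m))) x :=
    MDifferentiableAt.clm_bundle_apply ((hτ x).mdifferentiableAt (by simp)) hX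
  rw [mdifferentiableAt_totalSpace] at this
  exact this.2

/-- An operator on vector fields which is additive at `x` distributes over sums of four fields. -/
theorem map_sum_four {A : Type*} [AddCommGroup A] {x : M} (T : VField M → A)
    (hT : ∀ X Y, DiffFieldAt X x → DiffFieldAt Y x → T (X + Y) = T X + T Y)
    {X : Fin 4 → VField M} (hX : ∀ i, DiffFieldAt (X i) x) :
    T (fun y => ∑ i, X i y) = ∑ i, T (X i) := by
  simp only [Fin.sum_univ_four]
  change T (X 0 + X 1 + X 2 + X 3) = _
  have h1 : DiffFieldAt (X 0 + X 1) x := (hX 0).add (hX 1)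
  have h2 : DiffFieldAt (X 0 + X 1 + X 2) x := h1.add (hX 2)
  rw [hT _ _ h2 (hX 3), hT _ _ h1 (hX 2), hT _ _ (hX 0) (hX 1)]

theorem lieBracket_smul_right {f : M → ℝ} {X Y : VField M} {x : M} (hf : DiffFunAt f x)
    (hY : DiffFieldAt Y x) :
    VectorField.mlieBracket (𝓡 4) X (fun y => f y • Y y) x
      = dirD X f x • Y x + f x • VectorField.mlieBracket (𝓡 4) X Y x :=
  VectorField.mlieBracket_smul_right hf hY

theorem jacobi_lieBracket {X Y Z : VField M} (hX : SmoothField X) (hY : SmoothField Y)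
    (hZ : SmoothField Z) (x : M) :
    VectorField.mlieBracket (𝓡 4) X (VectorField.mlieBracket (𝓡 4) Y Z) x
      = VectorField.mlieBracket (𝓡 4) (VectorField.mlieBracket (𝓡 4) X Y) Z x
        + VectorField.mlieBracket (𝓡 4) Y (VectorField.mlieBracket (𝓡 4) X Z) x := by
  have h (W : VField M) (hW : SmoothField W) :
      ContMDiffAt (𝓡 4) (𝓡 4).tangent (minSmoothness ℝ 2)
        (fun y => (W y : TangentBundle (𝓡 4) M)) x := by
    rw [minSmoothness_of_isRCLikeNormedField]
    exact (hW x).of_le (WithTop.coe_le_coe.2 (le_top (a := (2 : ℕ∞))))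
  exact VectorField.leibniz_identity_mlieBracket_apply (h X hX) (h Y hY) (h Z hZ)

end Calculus

/-! ### Frames and structure functions -/

section Frame

variable {M : Type*} [TopologicalSpace M] [ChartedSpace (EuclideanSpace ℝ (Fin 4)) M]
  [IsManifold (𝓡 4) ∞ M]

attribute [local instance] isManifold_minSmoothness_two isManifold_minSmoothness_three

/-- The structure functions `c k i j = θ_k([E_i, E_j])` of a frame. -/
noncomputable def structFun (θ : Fin 4 → OneForm M) (E : Fin 4 → VField M) (k i j : Fin 4)
    (x : M) : ℝ :=
  θ k x (VectorField.mlieBracket (𝓡 4) (E i) (E j) x)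

variable {θ : Fin 4 → OneForm M} {E : Fin 4 → VField M}

namespace IsDualCoframe

theorem dual_self (hθ : IsDualCoframe θ E) (i : Fin 4) (x : M) : θ i x (E i x) = 1 := by
  simp [hθ.dual]

theorem coeff_sum (hθ : IsDualCoframe θ E) (x : M) (c : Fin 4 → ℝ) (k : Fin 4) :
    θ k x (∑ i, c i • E i x) = c k := by
  simp [map_sum, hθ.dual]

/-- Tangent vectors are determined by their components in the coframe. -/
theorem ext (hθ : IsDualCoframe θ E) {x : M} {u v : TangentSpace (𝓡 4) x}
    (h : ∀ i, θ i x u = θ i x v) : u = v := by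
  let T : TangentSpace (𝓡 4) x →ₗ[ℝ] (Fin 4 → ℝ) := LinearMap.pi fun i => (θ i x : _ →ₗ[ℝ] ℝ)
  have hs : Function.Surjective T := fun c =>
    ⟨∑ i, c i • E i x, by ext k; exact hθ.coeff_sum x c k⟩
  have : FiniteDimensional ℝ (TangentSpace (𝓡 4) x) :=
    inferInstanceAs (FiniteDimensional ℝ (EuclideanSpace ℝ (Fin 4)))
  have hd : Module.finrank ℝ (TangentSpace (𝓡 4) x) = Module.finrank ℝ (Fin 4 → ℝ) := by
    change Module.finrank ℝ (EuclideanSpace ℝ (Fin 4)) = _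
    simp
  have hi : Function.Injective T :=
    (LinearMap.injective_iff_surjective_of_finrank_eq_finrank hd).2 hs
  exact hi (funext h)

theorem expand (hθ : IsDualCoframe θ E) {x : M} (v : TangentSpace (𝓡 4) x) :
    ∑ i, θ i x v • E i x = v :=
  hθ.ext fun k => hθ.coeff_sum x _ k

theorem expand_field (hθ : IsDualCoframe θ E) (X : VField M) :
    (fun y => ∑ i, θ i y (X y) • E i y) = X :=
  funext fun y => hθ.expand (X y)

/-- A 1-form is determined by its values on the frame. -/
theorem form_expand (hθ : IsDualCoframe θ E) {x : M} (τ : TangentSpace (𝓡 4) x →L[ℝ] ℝ)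
    (v : TangentSpace (𝓡 4) x) : τ v = ∑ i, θ i x v * τ (E i x) := by
  conv_lhs => rw [← hθ.expand v]
  simp [map_sum]

theorem dirD_expand (hθ : IsDualCoframe θ E) (X : VField M) (f : M → ℝ) (x : M) :
    dirD X f x = ∑ i, θ i x (X x) * dirD (E i) f x :=
  hθ.form_expand _ _

theorem smooth_coeff (hθ : IsDualCoframe θ E) {X : VField M} (hX : SmoothField X) (k : Fin 4) :
    SmoothFun fun y => θ k y (X y) :=
  (hθ.smooth_coframe k).apply hX

theorem smooth_of_coeff (hθ : IsDualCoframe θ E) {X : VField M}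
    (hX : ∀ k, SmoothFun fun y => θ k y (X y)) : SmoothField X := by
  have := SmoothField.sum fun i => SmoothField.smul (hX i) (hθ.smooth_frame i)
  rwa [hθ.expand_field X] at this

theorem diff_coeff (hθ : IsDualCoframe θ E) {X : VField M} {x : M} (hX : DiffFieldAt X x)
    (k : Fin 4) : DiffFunAt (fun y => θ k y (X y)) x :=
  (hθ.smooth_coframe k).diff_apply hX

omit [IsManifold (𝓡 4) ∞ M] in
theorem structFun_swap (θ : Fin 4 → OneForm M) (E : Fin 4 → VField M) (k i j : Fin 4) (x : M) :
    structFun θ E k i j x = -structFun θ E k j i x := by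
  unfold structFun
  rw [VectorField.mlieBracket_swap_apply, map_neg]

/-- The derivative of a smooth function along a smooth field is smooth: `(X f) Z` is the
difference of the smooth fields `[X, f Z]` and `f [X, Z]`. -/
theorem smooth_dirD (hθ : IsDualCoframe θ E) {X : VField M} {f : M → ℝ} (hX : SmoothField X)
    (hf : SmoothFun f) : SmoothFun (dirD X f) := by
  have hE := hθ.smooth_frame 0
  have h1 := hθ.smooth_coeff (hX.bracket (SmoothField.smul hf hE)) 0
  have h2 := hθ.smooth_coeff (SmoothField.smul hf (hX.bracket hE)) 0
  refine (h1.sub h2).congr fun y => ?_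
  rw [lieBracket_smul_right (hf.diffAt y) (hE.diffAt y)]
  simp [hθ.dual]

/-- The Lie bracket of vector fields is the commutator of derivations. It follows from the Jacobi
identity for `X`, `Y` and `f Z`, with `Z` a nowhere vanishing field. -/
theorem dirD_commutator (hθ : IsDualCoframe θ E) {X Y : VField M} {f : M → ℝ}
    (hX : SmoothField X) (hY : SmoothField Y) (hf : SmoothFun f) (x : M) :
    dirD X (dirD Y f) x - dirD Y (dirD X f) x
      = dirD (VectorField.mlieBracket (𝓡 4) X Y) f x := by
  have hE := hθ.smooth_frame 0
  have key (U V : VField M) (hU : SmoothField U) (hV : SmoothField V) :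
      VectorField.mlieBracket (𝓡 4) U
          (VectorField.mlieBracket (𝓡 4) V (fun y => f y • E 0 y)) x
        = dirD U (dirD V f) x • E 0 x
          + dirD V f x • VectorField.mlieBracket (𝓡 4) U (E 0) x
          + (dirD U f x • VectorField.mlieBracket (𝓡 4) V (E 0) x
            + f x • VectorField.mlieBracket (𝓡 4) U
                (VectorField.mlieBracket (𝓡 4) V (E 0)) x) := by
    have e : VectorField.mlieBracket (𝓡 4) V (fun y => f y • E 0 y)
        = (fun y => dirD V f y • E 0 y)
          + fun y => f y • VectorField.mlieBracket (𝓡 4) V (E 0) y :=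
      funext fun y => lieBracket_smul_right (hf.diffAt y) (hE.diffAt y)
    have hVf := hθ.smooth_dirD hV hf
    have hVE := hV.bracket hE
    rw [e, VectorField.mlieBracket_add_right ((SmoothField.smul hVf hE).diffAt x)
      ((SmoothField.smul hf hVE).diffAt x), lieBracket_smul_right (hVf.diffAt x) (hE.diffAt x),
      lieBracket_smul_right (hf.diffAt x) (hVE.diffAt x)]
  have J := jacobi_lieBracket hX hY (SmoothField.smul hf hE) x
  have J' := jacobi_lieBracket hX hY hE x
  rw [key X Y hX hY, key Y X hY hX, lieBracket_smul_right (hf.diffAt x) (hE.diffAt x), J'] at J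
  have := congrArg (θ 0 x) J
  simp only [map_add, map_smul, smul_eq_mul, hθ.dual_self] at this
  linear_combination this

/-- The components of a Lie bracket in a frame. -/
theorem bracket_coeff (hθ : IsDualCoframe θ E) {X Y : VField M} {x : M} (hX : DiffFieldAt X x)
    (hY : DiffFieldAt Y x) (k : Fin 4) :
    θ k x (VectorField.mlieBracket (𝓡 4) X Y x)
      = dirD X (fun y => θ k y (Y y)) x - dirD Y (fun y => θ k y (X y)) x
        + ∑ i, ∑ j, θ i x (X x) * θ j x (Y x) * structFun θ E k i j x := by
  have hE i := (hθ.smooth_frame i).diffAt x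
  have right (Z : VField M) (hZ : DiffFieldAt Z x) {W : VField M} (hW : DiffFieldAt W x) :
      θ k x (VectorField.mlieBracket (𝓡 4) Z W x)
        = dirD Z (fun y => θ k y (W y)) x
          + ∑ j, θ j x (W x) * θ k x (VectorField.mlieBracket (𝓡 4) Z (E j) x) := by
    conv_lhs => rw [← hθ.expand_field W]
    rw [map_sum_four (x := x) (fun V => VectorField.mlieBracket (𝓡 4) Z V x)
      (fun U V hU hV => VectorField.mlieBracket_add_right hU hV)
      (fun i => DiffFieldAt.smul (hθ.diff_coeff hW i) (hE i))]
    simp only [lieBracket_smul_right (hθ.diff_coeff hW _) (hE _), map_sum, map_add, map_smul,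
      smul_eq_mul, hθ.dual, mul_ite, mul_one, mul_zero, Finset.sum_add_distrib,
      Finset.sum_ite_eq, Finset.mem_univ, if_true]
  have left (j : Fin 4) : θ k x (VectorField.mlieBracket (𝓡 4) X (E j) x)
      = -dirD (E j) (fun y => θ k y (X y)) x
        + ∑ i, θ i x (X x) * structFun θ E k i j x := by
    rw [VectorField.mlieBracket_swap_apply, map_neg, right (E j) (hE j) hX, neg_add,
      ← Finset.sum_neg_distrib]
    congr 1
    refine Finset.sum_congr rfl fun i _ => ?_
    rw [structFun_swap, structFun]
    ring
  rw [right X hX hY, hθ.dirD_expand Y]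
  simp only [left, mul_add, Finset.sum_add_distrib, Finset.mul_sum]
  rw [Finset.sum_comm, ← add_assoc]
  congr 1
  · simp [sub_eq_add_neg]
  · refine Finset.sum_congr rfl fun i _ => Finset.sum_congr rfl fun j _ => ?_
    ring

/-- The Jacobi identity in terms of the structure functions. -/
theorem jacobi_structFun (hθ : IsDualCoframe θ E) (l i j k : Fin 4) (x : M) :
    dirD (E i) (structFun θ E l j k) x + dirD (E j) (structFun θ E l k i) x
      + dirD (E k) (structFun θ E l i j) x
      + ∑ m, (structFun θ E m j k x * structFun θ E l i m x
        + structFun θ E m k i x * structFun θ E l j m x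
        + structFun θ E m i j x * structFun θ E l k m x) = 0 := by
  have hE i := hθ.smooth_frame i
  have key (i j k : Fin 4) : θ l x (VectorField.mlieBracket (𝓡 4) (E i)
      (VectorField.mlieBracket (𝓡 4) (E j) (E k)) x)
      = dirD (E i) (structFun θ E l j k) x
        + ∑ m, structFun θ E m j k x * structFun θ E l i m x := by
    rw [hθ.bracket_coeff ((hE i).diffAt x) (((hE j).bracket (hE k)).diffAt x)]
    simp only [hθ.dual, dirD_const, sub_zero]
    change dirD (E i) (structFun θ E l j k) x + _ = _
    congr 1
    simp [structFun]
  have J := congrArg (θ l x) (jacobi_lieBracket (hE i) (hE j) (hE k) x)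
  have hswap : VectorField.mlieBracket (𝓡 4) (E i) (E k)
      = fun y => (-1 : ℝ) • VectorField.mlieBracket (𝓡 4) (E k) (E i) y := by
    funext y
    rw [VectorField.mlieBracket_swap_apply]
    simp
  rw [map_add, VectorField.mlieBracket_swap_apply (V := VectorField.mlieBracket (𝓡 4) (E i) (E j)),
    hswap, lieBracket_smul_right (f := fun _ => (-1 : ℝ)) mdifferentiableAt_const
      (((hE k).bracket (hE i)).diffAt x), map_add, map_smul, map_smul, map_neg,
    key, key, key, dirD_const] at J
  simp only [Finset.sum_add_distrib]
  simp only [smul_eq_mul] at J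
  linear_combination J

/-- An exterior derivative is determined by its values on the frame. -/
theorem dOne_expand (hθ : IsDualCoframe θ E) {τ : OneForm M} (hτ : SmoothOneForm τ)
    {X Y : VField M} (hX : SmoothField X) (hY : SmoothField Y) (x : M) :
    dOne τ X Y x = ∑ i, ∑ j, θ i x (X x) * θ j x (Y x) *
      (dirD (E i) (fun y => τ y (E j y)) x - dirD (E j) (fun y => τ y (E i y)) x
        - ∑ m, structFun θ E m i j x * τ x (E m x)) := by
  have hc (k : Fin 4) : DiffFunAt (fun y => τ y (E k y)) x :=
    (hτ.apply (hθ.smooth_frame k)).diffAt x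
  have e (U V : VField M) (hV : SmoothField V) : dirD U (fun y => τ y (V y)) x
      = ∑ k, (θ k x (V x) * dirD U (fun y => τ y (E k y)) x
        + dirD U (fun y => θ k y (V y)) x * τ x (E k x)) := by
    have hV' (k : Fin 4) : DiffFunAt (fun y => θ k y (V y)) x := (hθ.smooth_coeff hV k).diffAt x
    rw [funext fun y => hθ.form_expand (τ y) (V y), dirD_sum U fun k => (hV' k).mul (hc k)]
    simp only [dirD_mul U (hV' _) (hc _)]
  unfold dOne
  rw [e X Y hY, e Y X hX, hθ.form_expand (τ x) (VectorField.mlieBracket (𝓡 4) X Y x)]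
  simp only [hθ.bracket_coeff (hX.diffAt x) (hY.diffAt x), hθ.dirD_expand X, hθ.dirD_expand Y,
    Fin.sum_univ_four]
  ring

end IsDualCoframe

end Frame

/-! ### The metric of an orthonormal coframe -/

section NormedSpace

theorem contDiff_smulRight_self (V : Type*) [NormedAddCommGroup V] [NormedSpace ℝ V] :
    ContDiff ℝ ∞ fun f : V →L[ℝ] ℝ => f.smulRight f :=
  contDiff_id.smulRight contDiff_id

/-- Vectors with bounded components are bounded. -/
theorem isVonNBounded_sum_mul_self_lt_one {V : Type*} [NormedAddCommGroup V] [NormedSpace ℝ V]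
    (f : Fin 4 → V →L[ℝ] ℝ) (e : Fin 4 → V) (h : ∀ v, ∑ i, f i v • e i = v) :
    Bornology.IsVonNBounded ℝ {v : V | ∑ i, f i v * f i v < 1} := by
  rw [NormedSpace.isVonNBounded_iff]
  refine (Metric.isBounded_closedBall (x := (0 : V)) (r := ∑ i, ‖e i‖)).subset fun v hv => ?_
  rw [mem_closedBall_zero_iff]
  have hv1 : ∑ i, f i v * f i v < 1 := hv
  have hle (i : Fin 4) : |f i v| ≤ 1 := by
    have := Finset.single_le_sum (f := fun i => f i v * f i v)
      (fun i _ => mul_self_nonneg _) (Finset.mem_univ i)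
    exact abs_le_one_iff_mul_self_le_one.2 (this.trans hv1.le)
  calc ‖v‖ = ‖∑ i, f i v • e i‖ := by rw [h]
    _ ≤ ∑ i, ‖f i v • e i‖ := norm_sum_le _ _
    _ ≤ ∑ i, ‖e i‖ := Finset.sum_le_sum fun i _ => by
        rw [norm_smul]
        exact mul_le_of_le_one_left (norm_nonneg _) (hle i)

end NormedSpace

section FrameMetric

variable {M : Type*} [TopologicalSpace M] [ChartedSpace (EuclideanSpace ℝ (Fin 4)) M]
  [IsManifold (𝓡 4) ∞ M]

theorem contMDiff_sum_smulRight_self {τ : Fin 4 → OneForm M} (hτ : ∀ i, SmoothOneForm (τ i)) :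
    ContMDiff (𝓡 4) ((𝓡 4).prod 𝓘(ℝ, EuclideanSpace ℝ (Fin 4) →L[ℝ]
        EuclideanSpace ℝ (Fin 4) →L[ℝ] ℝ)) ∞
      (fun x => Bundle.TotalSpace.mk' (EuclideanSpace ℝ (Fin 4) →L[ℝ]
        EuclideanSpace ℝ (Fin 4) →L[ℝ] ℝ)
        (E := fun y : M => TangentSpace (𝓡 4) y →L[ℝ] TangentSpace (𝓡 4) y →L[ℝ] ℝ) x
        (∑ i, (τ i x).smulRight (τ i x))) := by
  intro x
  have h i := (contMDiffAt_hom_bundle _).1 (hτ i x)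
  rw [contMDiffAt_hom_bundle]
  refine ⟨contMDiffAt_id, ?_⟩
  have h3 i := (contDiff_smulRight_self
    (EuclideanSpace ℝ (Fin 4))).contMDiff.contMDiffAt.comp x (h i).2
  have h4 := (((h3 0).add (h3 1)).add (h3 2)).add (h3 3)
  refine h4.congr_of_eventuallyEq ?_
  have hb : ∀ᶠ y in 𝓝 x, y ∈ (trivializationAt (EuclideanSpace ℝ (Fin 4))
      (TangentSpace (𝓡 4) : M → Type _) x).baseSet :=
    (trivializationAt (EuclideanSpace ℝ (Fin 4))
      (TangentSpace (𝓡 4) : M → Type _) x).open_baseSet.mem_nhds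
        (FiberBundle.mem_baseSet_trivializationAt' x)
  filter_upwards [hb] with y hy
  have hy' : y ∈ (trivializationAt (EuclideanSpace ℝ (Fin 4) →L[ℝ] ℝ)
      (fun b : M => TangentSpace (𝓡 4) b →L[ℝ] Bundle.Trivial M ℝ b) x).baseSet := by
    rw [hom_trivializationAt_baseSet]
    exact ⟨hy, by simp⟩
  have hl (t : TangentSpace (𝓡 4) y →L[ℝ] ℝ) (v : EuclideanSpace ℝ (Fin 4)) :
      (Bundle.Trivialization.linearMapAt ℝ (trivializationAt (EuclideanSpace ℝ (Fin 4) →L[ℝ] ℝ)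
        (fun b : M => TangentSpace (𝓡 4) b →L[ℝ] Bundle.Trivial M ℝ b) x) y t) v
      = t ((Bundle.Trivialization.symmL ℝ (trivializationAt (EuclideanSpace ℝ (Fin 4))
          (TangentSpace (𝓡 4)) x) y) v) := by
    rw [Bundle.Trivialization.coe_linearMapAt_of_mem _ hy']
    change (ContinuousLinearMap.inCoordinates (EuclideanSpace ℝ (Fin 4))
      (TangentSpace (𝓡 4) : M → Type _) ℝ (Bundle.Trivial M ℝ) x y x y t) v = _
    simp [ContinuousLinearMap.inCoordinates]
  ext u v
  simp [ContinuousLinearMap.inCoordinates, Fin.sum_univ_four]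
  simp only [hl]

variable {θ : Fin 4 → OneForm M} {E : Fin 4 → VField M}

/-- The Riemannian metric `∑ θ_i ⊗ θ_i` which makes a coframe orthonormal. -/
noncomputable def IsDualCoframe.metric (hθ : IsDualCoframe θ E) : Metric4 M where
  inner x := ∑ i, (θ i x).smulRight (θ i x)
  symm x v w := by simp [sum_apply, mul_comm]
  pos x v hv := by
    simp only [sum_apply, ContinuousLinearMap.smulRight_apply,
      smul_apply, smul_eq_mul]
    have h0 : ∀ i ∈ Finset.univ, 0 ≤ θ i x v * θ i x v := fun i _ => mul_self_nonneg _
    refine lt_of_le_of_ne (Finset.sum_nonneg h0) fun h => hv (hθ.ext fun i => ?_)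
    have := (Finset.sum_eq_zero_iff_of_nonneg h0).1 h.symm i (Finset.mem_univ i)
    simpa using this
  isVonNBounded x := by
    have h := isVonNBounded_sum_mul_self_lt_one (V := EuclideanSpace ℝ (Fin 4)) (fun i => θ i x)
      (fun i => E i x) (fun v => hθ.expand (x := x) v)
    simpa using! h
  contMDiff := by
    exact contMDiff_sum_smulRight_self hθ.smooth_coframe

theorem IsDualCoframe.metric_apply (hθ : IsDualCoframe θ E) (x : M)
    (u v : TangentSpace (𝓡 4) x) :
    hθ.metric.inner x u v = ∑ i, θ i x u * θ i x v := by
  simp [IsDualCoframe.metric, sum_apply]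

end FrameMetric

/-! ### The Levi-Civita connection and the curvature of an orthonormal frame -/

section LeviCivita

variable {M : Type*} [TopologicalSpace M] [ChartedSpace (EuclideanSpace ℝ (Fin 4)) M]
  [IsManifold (𝓡 4) ∞ M] {θ : Fin 4 → OneForm M} {E : Fin 4 → VField M}

attribute [local instance] isManifold_minSmoothness_two isManifold_minSmoothness_three

/-- `Γ` is the family of Levi-Civita connection coefficients `Γ i j k = g(∇_{E_i} E_j, E_k)` of the
orthonormal frame `E`. -/
structure IsConnectionCoeff (θ : Fin 4 → OneForm M) (E : Fin 4 → VField M)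
    (Γ : Fin 4 → Fin 4 → Fin 4 → M → ℝ) : Prop where
  smooth : ∀ i j k, SmoothFun (Γ i j k)
  skew : ∀ i j k x, Γ i k j x = -Γ i j k x
  torsion : ∀ k i j x, structFun θ E k i j x = Γ i j k x - Γ j i k x

/-- The connection 1-form `ω_jk = ∑ i, Γ i j k • θ_i`. -/
noncomputable def connForm (θ : Fin 4 → OneForm M) (Γ : Fin 4 → Fin 4 → Fin 4 → M → ℝ)
    (j k : Fin 4) : OneForm M :=
  fun x => ∑ i, Γ i j k x • θ i x

/-- The frame components `g(R(E_i, E_j) E_k, E_l)` of the curvature of the connection with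
coefficients `Γ`. -/
noncomputable def curvCoeff (θ : Fin 4 → OneForm M) (E : Fin 4 → VField M)
    (Γ : Fin 4 → Fin 4 → Fin 4 → M → ℝ) (i j k l : Fin 4) (x : M) : ℝ :=
  dirD (E i) (Γ j k l) x - dirD (E j) (Γ i k l) x
    - ∑ m, structFun θ E m i j x * Γ m k l x
    + ∑ m, (Γ j k m x * Γ i m l x - Γ i k m x * Γ j m l x)

/-- The curvature tensor with frame components `curvCoeff`. -/
noncomputable def curvTensor (θ : Fin 4 → OneForm M) (E : Fin 4 → VField M)
    (Γ : Fin 4 → Fin 4 → Fin 4 → M → ℝ) : CurvField M := fun x =>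
  LinearMap.mk₂ ℝ (fun u v => ∑ i, ∑ j, ∑ k, ∑ l,
      (θ i x u * θ j x v * curvCoeff θ E Γ i j k l x) •
        ((θ k x : TangentSpace (𝓡 4) x →ₗ[ℝ] ℝ).smulRight (E l x)))
    (by intros; simp only [map_add, add_mul, add_smul, Finset.sum_add_distrib])
    (by intros; simp only [map_smul, smul_eq_mul, mul_assoc, mul_smul, Finset.smul_sum])
    (by intros; simp only [map_add, add_mul, mul_add, add_smul, Finset.sum_add_distrib])
    (by
      intros
      simp only [map_smul, smul_eq_mul, Finset.smul_sum, smul_smul]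
      refine Finset.sum_congr rfl fun i _ => Finset.sum_congr rfl fun j _ =>
        Finset.sum_congr rfl fun k _ => Finset.sum_congr rfl fun l _ => ?_
      congr 1
      ring)

variable {Γ : Fin 4 → Fin 4 → Fin 4 → M → ℝ}

omit [IsManifold (𝓡 4) ∞ M] in
theorem connForm_apply (j k : Fin 4) (x : M) (v : TangentSpace (𝓡 4) x) :
    connForm θ Γ j k x v = ∑ i, Γ i j k x * θ i x v := by
  simp [connForm]

theorem SmoothOneForm.add {σ τ : OneForm M} (hσ : SmoothOneForm σ) (hτ : SmoothOneForm τ) :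
    SmoothOneForm fun x => σ x + τ x :=
  ContMDiff.add_section hσ hτ

theorem SmoothOneForm.smul {f : M → ℝ} {τ : OneForm M} (hf : SmoothFun f)
    (hτ : SmoothOneForm τ) : SmoothOneForm fun x => f x • τ x :=
  ContMDiff.smul_section hf hτ

namespace IsConnectionCoeff

theorem smooth_connForm (hθ : IsDualCoframe θ E) (hΓ : IsConnectionCoeff θ E Γ) (j k : Fin 4) :
    SmoothOneForm (connForm θ Γ j k) := by
  have h i := SmoothOneForm.smul (hΓ.smooth i j k) (hθ.smooth_coframe i)
  have := (((h 0).add (h 1)).add (h 2)).add (h 3)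
  unfold connForm
  simpa only [Fin.sum_univ_four] using this

end IsConnectionCoeff

/-- The covariant derivative `∇ Y = ∑ l, (d Y_l + ∑ k, Y_k ω_kl) ⊗ E_l` of a vector field `Y` with
components `Y_l = θ_l(Y)`. -/
noncomputable def frameNabla (θ : Fin 4 → OneForm M) (E : Fin 4 → VField M)
    (Γ : Fin 4 → Fin 4 → Fin 4 → M → ℝ) (Y : VField M) (x : M) :
    TangentSpace (𝓡 4) x →L[ℝ] TangentSpace (𝓡 4) x :=
  ∑ l, (mvfderiv (𝓡 4) (fun y => θ l y (Y y)) x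
    + ∑ k, θ k x (Y x) • connForm θ Γ k l x).smulRight (E l x)

namespace IsDualCoframe

theorem frameNabla_coeff (hθ : IsDualCoframe θ E) (Γ : Fin 4 → Fin 4 → Fin 4 → M → ℝ)
    (Y : VField M) (x : M) (v : TangentSpace (𝓡 4) x) (l : Fin 4) :
    θ l x (frameNabla θ E Γ Y x v) = mvfderiv (𝓡 4) (fun y => θ l y (Y y)) x v
      + ∑ k, θ k x (Y x) * connForm θ Γ k l x v := by
  unfold frameNabla
  simp [hθ.dual]

/-- The connection with coefficients `Γ` in the frame `E`. -/
noncomputable def connection (hθ : IsDualCoframe θ E) (Γ : Fin 4 → Fin 4 → Fin 4 → M → ℝ) :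
    Connection4 M where
  toFun := frameNabla θ E Γ
  isCovariantDerivativeOnUniv :=
    { add := by
        intro X Y x hX hY _
        ext1 v
        refine hθ.ext fun l => ?_
        have h := congrArg (fun t => t v) (mvfderiv_add (hθ.diff_coeff hX l) (hθ.diff_coeff hY l))
        rw [add_apply, map_add]
        simp only [hθ.frameNabla_coeff, Pi.add_apply, map_add, add_mul, Finset.sum_add_distrib]
        refine (congrArg (· + _) h).trans ?_
        simp only [add_apply]
        ring
      leibniz := by
        intro Y f x hY hf _
        ext1 v
        refine hθ.ext fun l => ?_
        have h := congrArg (fun t => t v) (mvfderiv_mul hf (hθ.diff_coeff hY l))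
        rw [add_apply, map_add, smul_apply, map_smul,
          ContinuousLinearMap.smulRight_apply, map_smul]
        simp only [hθ.frameNabla_coeff, Pi.smul_apply', map_smul, smul_eq_mul, mul_add,
          Finset.mul_sum, mul_assoc]
        refine (congrArg (· + _) h).trans ?_
        simp only [add_apply, smul_apply, smul_eq_mul]
        ring }

theorem connection_coeff (hθ : IsDualCoframe θ E) (Γ : Fin 4 → Fin 4 → Fin 4 → M → ℝ)
    (Y : VField M) (x : M) (v : TangentSpace (𝓡 4) x) (l : Fin 4) :
    θ l x (hθ.connection Γ Y x v) = mvfderiv (𝓡 4) (fun y => θ l y (Y y)) x v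
      + ∑ k, θ k x (Y x) * connForm θ Γ k l x v :=
  hθ.frameNabla_coeff Γ Y x v l

end IsDualCoframe

namespace IsConnectionCoeff

omit [IsManifold (𝓡 4) ∞ M] in
theorem connForm_skew (hΓ : IsConnectionCoeff θ E Γ) (j k : Fin 4) (x : M)
    (v : TangentSpace (𝓡 4) x) : connForm θ Γ k j x v = -connForm θ Γ j k x v := by
  simp only [connForm_apply, hΓ.skew _ j k, neg_mul, Finset.sum_neg_distrib]

theorem isLeviCivita (hθ : IsDualCoframe θ E) (hΓ : IsConnectionCoeff θ E Γ) :
    IsLeviCivita hθ.metric (hθ.connection Γ) where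
  torsion_free := by
    rw [CovariantDerivative.torsion_eq_zero_iff]
    intro X Y x hX hY
    refine hθ.ext fun l => ?_
    rw [map_sub, hθ.connection_coeff, hθ.connection_coeff, hθ.bracket_coeff hX hY]
    simp only [hΓ.torsion, connForm_apply, dirD, Fin.sum_univ_four]
    ring
  metric := by
    intro X Y x hX hY v
    simp only [hθ.metric_apply, hθ.connection_coeff]
    -- a vector field with the value `v` at `x`, to express the derivative along `v`
    obtain ⟨V, rfl⟩ : ∃ V : VField M, V x = v :=
      ⟨fun y => ∑ i, θ i x v • E i y, hθ.expand v⟩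
    change dirD V (fun y => ∑ i, θ i y (X y) * θ i y (Y y)) x = _
    rw [dirD_sum V fun i => (hθ.diff_coeff hX i).mul (hθ.diff_coeff hY i)]
    have hm i := dirD_mul V (hθ.diff_coeff hX i) (hθ.diff_coeff hY i)
    simp only [hm]
    simp only [dirD, Fin.sum_univ_four]
    have hs j k := hΓ.connForm_skew j k x (V x)
    have hd j : connForm θ Γ j j x (V x) = 0 := by linarith [hs j j]
    rw [hs 0 1, hs 0 2, hs 0 3, hs 1 2, hs 1 3, hs 2 3, hd, hd, hd, hd]
    ring

/-- A metric torsion-free connection has the given coefficients: the difference of the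
coefficients is skew in the last two indices and symmetric in the first two, hence zero. -/
theorem frame_eq (hθ : IsDualCoframe θ E) (hΓ : IsConnectionCoeff θ E Γ) {nab : Connection4 M}
    (hn : IsLeviCivita hθ.metric nab) (i j k : Fin 4) (x : M) :
    θ k x (nab (E j) x (E i x)) = Γ i j k x := by
  have hE i := (hθ.smooth_frame i).diffAt x
  have hskew (i j k : Fin 4) :
      θ j x (nab (E k) x (E i x)) = -θ k x (nab (E j) x (E i x)) := by
    have := hn.metric (E j) (E k) x (hE j) (hE k) (E i x)
    simp only [hθ.metric_apply, hθ.dual] at this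
    simp [mvfderiv_const] at this
    linarith
  have htor (i j k : Fin 4) : θ k x (nab (E j) x (E i x)) - θ k x (nab (E i) x (E j x))
      = Γ i j k x - Γ j i k x := by
    rw [← hΓ.torsion, structFun, ← map_sub,
      (CovariantDerivative.torsion_eq_zero_iff _).1 hn.torsion_free (hE i) (hE j)]
  linarith [hskew i j k, hskew j i k, hskew k i j, htor i j k, htor j k i, htor k i j,
    hΓ.skew i j k x, hΓ.skew j i k x, hΓ.skew k i j x]

/-- A Levi-Civita connection is determined on all differentiable fields by its coefficients. -/
theorem coeff_of_isLeviCivita (hθ : IsDualCoframe θ E) (hΓ : IsConnectionCoeff θ E Γ)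
    {nab : Connection4 M} (hn : IsLeviCivita hθ.metric nab) {Y : VField M} {x : M}
    (hY : DiffFieldAt Y x) (v : TangentSpace (𝓡 4) x) (l : Fin 4) :
    θ l x (nab Y x v) = mvfderiv (𝓡 4) (fun y => θ l y (Y y)) x v
      + ∑ k, θ k x (Y x) * connForm θ Γ k l x v := by
  have hE i := (hθ.smooth_frame i).diffAt x
  have hf (k : Fin 4) : θ l x (nab (E k) x v) = connForm θ Γ k l x v := by
    have := hθ.form_expand ((θ l x).comp (nab (E k) x)) v
    simp only [ContinuousLinearMap.comp_apply, hΓ.frame_eq hθ hn] at this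
    rw [this, connForm_apply]
    exact Finset.sum_congr rfl fun i _ => mul_comm _ _
  conv_lhs => rw [← hθ.expand_field Y]
  rw [map_sum_four (x := x) (fun V => nab V x)
    (fun U V hU hV => nab.isCovariantDerivativeOnUniv.add hU hV)
    (fun i => DiffFieldAt.smul (hθ.diff_coeff hY i) (hE i))]
  have hl (k : Fin 4) : nab (fun y => θ k y (Y y) • E k y) x = θ k x (Y x) • nab (E k) x
      + (mvfderiv (𝓡 4) (fun y => θ k y (Y y)) x).smulRight (E k x) :=
    nab.isCovariantDerivativeOnUniv.leibniz (hE k) (hθ.diff_coeff hY k)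
  simp only [hl, Finset.sum_add_distrib, add_apply, map_add]
  rw [add_comm]
  simp [hf, hθ.dual]

theorem smooth_covD (hθ : IsDualCoframe θ E) (hΓ : IsConnectionCoeff θ E Γ)
    {nab : Connection4 M} (hn : IsLeviCivita hθ.metric nab) {Y Z : VField M}
    (hY : SmoothField Y) (hZ : SmoothField Z) : SmoothField (covD nab Y Z) := by
  refine hθ.smooth_of_coeff fun l => ?_
  have h1 := hθ.smooth_dirD hY (hθ.smooth_coeff hZ l)
  have h2 k := (hθ.smooth_coeff hZ k).mul ((hΓ.smooth_connForm hθ k l).apply hY)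
  refine (h1.add (SmoothFun.sum h2)).congr fun y => ?_
  exact hΓ.coeff_of_isLeviCivita hθ hn (hZ.diffAt y) (Y y) l

theorem dOne_connForm (hθ : IsDualCoframe θ E) (hΓ : IsConnectionCoeff θ E Γ) (k l : Fin 4)
    {X Y : VField M} (hX : SmoothField X) (hY : SmoothField Y) (x : M) :
    dOne (connForm θ Γ k l) X Y x = ∑ i, ∑ j, θ i x (X x) * θ j x (Y x) *
      (dirD (E i) (Γ j k l) x - dirD (E j) (Γ i k l) x
        - ∑ m, structFun θ E m i j x * Γ m k l x) := by
  have h (j : Fin 4) (y : M) : connForm θ Γ k l y (E j y) = Γ j k l y := by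
    simp [connForm_apply, hθ.dual]
  simp only [hθ.dOne_expand (hΓ.smooth_connForm hθ k l) hX hY, h]

/-- Cartan's second structure equation `Ω_kl = dω_kl + ∑ m, ω_ml ∧ ω_km`. -/
theorem dOne_connForm_add (hθ : IsDualCoframe θ E) (hΓ : IsConnectionCoeff θ E Γ) (k l : Fin 4)
    {X Y : VField M} (hX : SmoothField X) (hY : SmoothField Y) (x : M) :
    dOne (connForm θ Γ k l) X Y x
      + ∑ m, (connForm θ Γ m l x (X x) * connForm θ Γ k m x (Y x)
        - connForm θ Γ m l x (Y x) * connForm θ Γ k m x (X x))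
      = ∑ i, ∑ j, θ i x (X x) * θ j x (Y x) * curvCoeff θ E Γ i j k l x := by
  rw [hΓ.dOne_connForm hθ k l hX hY]
  simp only [connForm_apply, curvCoeff, Fin.sum_univ_four]
  ring

theorem curvature_coeff (hθ : IsDualCoframe θ E) (hΓ : IsConnectionCoeff θ E Γ)
    {nab : Connection4 M} (hn : IsLeviCivita hθ.metric nab) {X Y Z : VField M}
    (hX : SmoothField X) (hY : SmoothField Y) (hZ : SmoothField Z) (x : M) (l : Fin 4) :
    θ l x (covD nab X (covD nab Y Z) x - covD nab Y (covD nab X Z) x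
        - covD nab (VectorField.mlieBracket (𝓡 4) X Y) Z x)
      = ∑ k, θ k x (Z x) * ∑ i, ∑ j,
          θ i x (X x) * θ j x (Y x) * curvCoeff θ E Γ i j k l x := by
  have hc (U W : VField M) (hW : SmoothField W) (l : Fin 4) (y : M) : θ l y (covD nab U W y)
      = dirD U (fun z => θ l z (W z)) y + ∑ k, θ k y (W y) * connForm θ Γ k l y (U y) :=
    hΓ.coeff_of_isLeviCivita hθ hn (hW.diffAt y) (U y) l
  have hω k l {U : VField M} (hU : SmoothField U) : SmoothFun fun y => connForm θ Γ k l y (U y) :=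
    (hΓ.smooth_connForm hθ k l).apply hU
  have hcc (U V : VField M) (hV : SmoothField V) :
      θ l x (covD nab U (covD nab V Z) x)
        = dirD U (dirD V fun z => θ l z (Z z)) x
          + ∑ k, (θ k x (Z x) * dirD U (fun y => connForm θ Γ k l y (V y)) x
            + dirD U (fun y => θ k y (Z y)) x * connForm θ Γ k l x (V x))
          + ∑ m, (dirD V (fun z => θ m z (Z z)) x + ∑ k, θ k x (Z x) * connForm θ Γ k m x (V x))
            * connForm θ Γ m l x (U x) := by
    have hs k := (hθ.smooth_coeff hZ k).mul (hω k l hV)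
    rw [hc U _ (hΓ.smooth_covD hθ hn hV hZ)]
    simp only [hc V Z hZ]
    congr 1
    rw [dirD_add U ((hθ.smooth_dirD hV (hθ.smooth_coeff hZ l)).diffAt x)
      ((SmoothFun.sum hs).diffAt x), dirD_sum U fun k => (hs k).diffAt x]
    simp only [dirD_mul U ((hθ.smooth_coeff hZ _).diffAt x) ((hω _ l hV).diffAt x)]
  have hdd := hθ.dirD_commutator hX hY (hθ.smooth_coeff hZ l) x
  have hd k := hΓ.dOne_connForm_add hθ k l hX hY x
  simp only [← hd]
  rw [map_sub, map_sub, hcc X Y hY, hcc Y X hX, hc _ Z hZ, ← hdd]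
  simp only [dOne, Fin.sum_univ_four]
  ring

theorem curvTensor_coeff (hθ : IsDualCoframe θ E) (x : M) (u v w : TangentSpace (𝓡 4) x)
    (l : Fin 4) : θ l x (curvTensor θ E Γ x u v w)
      = ∑ k, θ k x w * ∑ i, ∑ j, θ i x u * θ j x v * curvCoeff θ E Γ i j k l x := by
  simp only [curvTensor, LinearMap.mk₂_apply, LinearMap.sum_apply, LinearMap.smul_apply,
    LinearMap.smulRight_apply, map_sum, map_smul, smul_eq_mul, hθ.dual,
    ContinuousLinearMap.coe_coe, mul_ite, mul_one, mul_zero, Finset.sum_ite_eq, Finset.mem_univ,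
    if_true]
  simp only [Fin.sum_univ_four]
  ring

theorem isRiemannCurvature (hθ : IsDualCoframe θ E) (hΓ : IsConnectionCoeff θ E Γ) :
    IsRiemannCurvature hθ.metric (curvTensor θ E Γ) := by
  refine ⟨_, hΓ.isLeviCivita hθ, fun X Y Z hX hY hZ x => hθ.ext fun l => ?_⟩
  rw [hΓ.curvature_coeff hθ (hΓ.isLeviCivita hθ) hX hY hZ, curvTensor_coeff hθ]

/-- Every curvature tensor of the metric is the one computed in the frame, because each tangent
vector extends to a smooth field with constant components. -/
theorem eq_curvTensor (hθ : IsDualCoframe θ E) (hΓ : IsConnectionCoeff θ E Γ) {R : CurvField M}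
    (hR : IsRiemannCurvature hθ.metric R) : R = curvTensor θ E Γ := by
  obtain ⟨nab, hn, h⟩ := hR
  funext x
  ext u v w
  have hs (v : TangentSpace (𝓡 4) x) : ∃ V : VField M, SmoothField V ∧ V x = v :=
    ⟨fun y => ∑ i, θ i x v • E i y,
      SmoothField.sum fun i => SmoothField.smul (SmoothFun.const _) (hθ.smooth_frame i),
      hθ.expand v⟩
  obtain ⟨U, hU, rfl⟩ := hs u
  obtain ⟨V, hV, rfl⟩ := hs v
  obtain ⟨W, hW, rfl⟩ := hs w
  refine hθ.ext fun l => ?_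
  rw [h U V W hU hV hW, hΓ.curvature_coeff hθ hn hU hV hW, curvTensor_coeff hθ]

omit [IsManifold (𝓡 4) ∞ M] in
theorem curvCoeff_swap (i j k l : Fin 4) (x : M) :
    curvCoeff θ E Γ j i k l x = -curvCoeff θ E Γ i j k l x := by
  simp only [curvCoeff, IsDualCoframe.structFun_swap θ E _ j i, Fin.sum_univ_four]
  ring

omit [IsManifold (𝓡 4) ∞ M] in
theorem curvCoeff_skew (hΓ : IsConnectionCoeff θ E Γ) (i j k l : Fin 4) (x : M) :
    curvCoeff θ E Γ i j l k x = -curvCoeff θ E Γ i j k l x := by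
  have h i : Γ i l k = fun y => -Γ i k l y := funext fun y => hΓ.skew i k l y
  have h' i m y : Γ i m k y = -Γ i k m y := hΓ.skew i k m y
  have h'' i m y : Γ i l m y = -Γ i m l y := hΓ.skew i m l y
  simp only [curvCoeff, h, dirD_neg, h', h'', Fin.sum_univ_four]
  ring

/-- The first Bianchi identity, which is the Jacobi identity of the frame. -/
theorem bianchi (hθ : IsDualCoframe θ E) (hΓ : IsConnectionCoeff θ E Γ) (i j k l : Fin 4) (x : M) :
    curvCoeff θ E Γ i j k l x + curvCoeff θ E Γ j k i l x + curvCoeff θ E Γ k i j l x = 0 := by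
  have J := hθ.jacobi_structFun l i j k x
  have hf k i j : structFun θ E k i j = fun y => Γ i j k y - Γ j i k y :=
    funext fun y => hΓ.torsion k i j y
  simp only [hf, dirD_sub _ ((hΓ.smooth _ _ _).diffAt x) ((hΓ.smooth _ _ _).diffAt x)] at J
  simp only [curvCoeff, hf]
  simp only [Fin.sum_univ_four] at J ⊢
  linear_combination J

end IsConnectionCoeff
end LeviCivita

/-! ### The connection forms given by the structure equations -/

section Adapted

variable {M : Type*} [TopologicalSpace M] [ChartedSpace (EuclideanSpace ℝ (Fin 4)) M]

theorem dirD_const_mul (X : VField M) (r : ℝ) {f : M → ℝ} {x : M} (hf : DiffFunAt f x) :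
    dirD X (fun y => r * f y) x = r * dirD X f x := by
  rw [dirD_mul X mdifferentiableAt_const hf, dirD_const]
  ring

theorem SmoothFun.log_abs {f : M → ℝ} (hf : SmoothFun f) (h0 : ∀ x, f x ≠ 0) :
    SmoothFun fun y => Real.log |f y| := by
  intro x
  simp only [Real.log_abs]
  exact (Real.contDiffAt_log.2 (h0 x)).contMDiffAt.comp x (hf x)

theorem dirD_eq_mul_logD (X : VField M) {f : M → ℝ} {x : M} (hf : DiffFunAt f x)
    (h0 : f x ≠ 0) : dirD X f x = f x * logD X f x := by
  have h : HasMFDerivAt (𝓡 4) 𝓘(ℝ, ℝ) (fun y => Real.log (f y)) x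
      ((ContinuousLinearMap.toSpanSingleton ℝ (f x)⁻¹).comp (mfderiv (𝓡 4) 𝓘(ℝ, ℝ) f x)) :=
    (Real.hasDerivAt_log h0).hasFDerivAt.hasMFDerivAt.comp x hf.hasMFDerivAt
  have e : logD X f x = (f x)⁻¹ * dirD X f x := by
    have h1 : logD X f x = dirD X (fun y => Real.log (f y)) x := by
      simp only [logD, Real.log_abs]
    rw [h1, mul_comm]
    simp only [dirD, mvfderiv]
    rw [h.mfderiv]
    rfl
  rw [e]
  field_simp

variable [IsManifold (𝓡 4) ∞ M]

/-- The coefficients of the connection form `ω_01 = ω_23`. -/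
noncomputable def connP (a b : M → ℝ) : Fin 4 → M → ℝ :=
  ![fun x => -(1 / 2) * b x, fun x => 1 / 2 * a x, fun _ => 0, fun _ => 0]

/-- The coefficients of the connection form `ω_03 = ω_12`. -/
noncomputable def connQ (a b : M → ℝ) : Fin 4 → M → ℝ :=
  ![fun _ => 0, fun _ => 0, fun x => 1 / 2 * b x, fun x => 1 / 2 * a x]

/-- The coefficients of the connection form `ω_02`. -/
noncomputable def connA (E : Fin 4 → VField M) (a b : M → ℝ) : Fin 4 → M → ℝ :=
  ![fun x => -logD (E 2) a x, fun x => logD (E 3) a x, fun x => a x + logD (E 0) a x,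
    fun x => -b x - logD (E 1) a x]

/-- The coefficients of the connection form `ω_13`. -/
noncomputable def connB (E : Fin 4 → VField M) (a b : M → ℝ) : Fin 4 → M → ℝ :=
  ![fun x => logD (E 2) b x, fun x => -logD (E 3) b x, fun x => -a x - logD (E 0) b x,
    fun x => b x + logD (E 1) b x]

/-- The coefficients `Γ i j k` of the Levi-Civita connection, with values in the centralizer `u(2)`
of `J`. -/
noncomputable def adaptedCoeff (E : Fin 4 → VField M) (a b : M → ℝ) (i j k : Fin 4) : M → ℝ :=
  fun x => !![0, connP a b i x, connA E a b i x, connQ a b i x;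
    -connP a b i x, 0, connQ a b i x, connB E a b i x;
    -connA E a b i x, -connQ a b i x, 0, connP a b i x;
    -connQ a b i x, -connB E a b i x, -connP a b i x, 0] j k

variable {θ : Fin 4 → OneForm M} {E : Fin 4 → VField M} {a b : M → ℝ}

theorem smooth_logD (hθ : IsDualCoframe θ E) {X : VField M} (hX : SmoothField X) {f : M → ℝ}
    (hf : SmoothFun f) (h0 : ∀ x, f x ≠ 0) : SmoothFun (logD X f) :=
  hθ.smooth_dirD hX (hf.log_abs h0)

namespace StructureEquations

theorem dOne_one (hs : StructureEquations θ E a b) {X Y : VField M} (hX : SmoothField X)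
    (hY : SmoothField Y) (x : M) : dOne (θ 0) X Y x
      = -(1 / 2) * b x * (θ 0 x (X x) * θ 1 x (Y x) - θ 1 x (X x) * θ 0 x (Y x))
        + logD (E 3) a x * (θ 1 x (X x) * θ 2 x (Y x) - θ 2 x (X x) * θ 1 x (Y x))
        - logD (E 2) a x * (θ 0 x (X x) * θ 2 x (Y x) - θ 2 x (X x) * θ 0 x (Y x))
        + (3 / 2 * b x + logD (E 1) a x)
          * (θ 2 x (X x) * θ 3 x (Y x) - θ 3 x (X x) * θ 2 x (Y x)) :=
  (hs.d_one X Y hX hY x).symm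

theorem dOne_two (hs : StructureEquations θ E a b) {X Y : VField M} (hX : SmoothField X)
    (hY : SmoothField Y) (x : M) : dOne (θ 1) X Y x
      = 1 / 2 * a x * (θ 0 x (X x) * θ 1 x (Y x) - θ 1 x (X x) * θ 0 x (Y x))
        + logD (E 2) b x * (θ 0 x (X x) * θ 3 x (Y x) - θ 3 x (X x) * θ 0 x (Y x))
        - logD (E 3) b x * (θ 1 x (X x) * θ 3 x (Y x) - θ 3 x (X x) * θ 1 x (Y x))
        - (3 / 2 * a x + logD (E 0) b x)
          * (θ 2 x (X x) * θ 3 x (Y x) - θ 3 x (X x) * θ 2 x (Y x)) :=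
  (hs.d_two X Y hX hY x).symm

theorem dOne_three (hs : StructureEquations θ E a b) {X Y : VField M} (hX : SmoothField X)
    (hY : SmoothField Y) (x : M) : dOne (θ 2) X Y x
      = 1 / 2 * b x * (θ 1 x (X x) * θ 2 x (Y x) - θ 2 x (X x) * θ 1 x (Y x))
        + logD (E 3) a x * (θ 0 x (X x) * θ 1 x (Y x) - θ 1 x (X x) * θ 0 x (Y x))
        + a x * (θ 1 x (X x) * θ 3 x (Y x) - θ 3 x (X x) * θ 1 x (Y x))
        + (3 / 2 * b x + logD (E 1) a x) * (θ 3 x (X x) * θ 0 x (Y x) - θ 0 x (X x) * θ 3 x (Y x))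
        + (a x + logD (E 0) a x) * (θ 0 x (X x) * θ 2 x (Y x) - θ 2 x (X x) * θ 0 x (Y x)) :=
  (hs.d_three X Y hX hY x).symm

theorem dOne_four (hs : StructureEquations θ E a b) {X Y : VField M} (hX : SmoothField X)
    (hY : SmoothField Y) (x : M) : dOne (θ 3) X Y x
      = b x * (θ 0 x (X x) * θ 2 x (Y x) - θ 2 x (X x) * θ 0 x (Y x))
        - logD (E 2) b x * (θ 0 x (X x) * θ 1 x (Y x) - θ 1 x (X x) * θ 0 x (Y x))
        + 1 / 2 * a x * (θ 0 x (X x) * θ 3 x (Y x) - θ 3 x (X x) * θ 0 x (Y x))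
        + (3 / 2 * a x + logD (E 0) b x) * (θ 2 x (X x) * θ 1 x (Y x) - θ 1 x (X x) * θ 2 x (Y x))
        + (b x + logD (E 1) b x) * (θ 1 x (X x) * θ 3 x (Y x) - θ 3 x (X x) * θ 1 x (Y x)) :=
  (hs.d_four X Y hX hY x).symm

theorem isConnectionCoeff (hθ : IsDualCoframe θ E) (ha : SmoothFun a) (hb : SmoothFun b)
    (ha0 : ∀ x, a x ≠ 0) (hb0 : ∀ x, b x ≠ 0) (hs : StructureEquations θ E a b) :
    IsConnectionCoeff θ E (adaptedCoeff E a b) where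
  smooth := by
    have hA i := smooth_logD hθ (hθ.smooth_frame i) ha ha0
    have hB i := smooth_logD hθ (hθ.smooth_frame i) hb hb0
    have h0 : SmoothFun fun _ : M => (0 : ℝ) := SmoothFun.const 0
    intro i j k
    have h1 : SmoothFun (connP a b i) := by
      fin_cases i
      exacts [(SmoothFun.const _).mul hb, (SmoothFun.const _).mul ha, h0, h0]
    have h2 : SmoothFun (connQ a b i) := by
      fin_cases i
      exacts [h0, h0, (SmoothFun.const _).mul hb, (SmoothFun.const _).mul ha]
    have h3 : SmoothFun (connA E a b i) := by
      fin_cases i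
      exacts [(hA 2).neg, hA 3, ha.add (hA 0), hb.neg.sub (hA 1)]
    have h4 : SmoothFun (connB E a b i) := by
      fin_cases i
      exacts [hB 2, (hB 3).neg, ha.neg.sub (hB 0), hb.add (hB 1)]
    fin_cases j <;> fin_cases k
    exacts [h0, h1, h3, h2, h1.neg, h0, h2, h4, h3.neg, h2.neg, h0, h1, h2.neg, h4.neg, h1.neg, h0]
  skew := by
    intro i j k x
    fin_cases j <;> fin_cases k <;> simp [adaptedCoeff]
  torsion := by
    intro k i j x
    have h : structFun θ E k i j x = -dOne (θ k) (E i) (E j) x := by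
      simp [dOne, hθ.dual, dirD_const, structFun]
    rw [h]
    have hE := hθ.smooth_frame
    fin_cases k
    · refine (congrArg Neg.neg (hs.dOne_one (hE i) (hE j) x)).trans ?_
      fin_cases i <;> fin_cases j <;>
        simp [hθ.dual, adaptedCoeff, connP, connQ, connA, connB] <;> ring
    · refine (congrArg Neg.neg (hs.dOne_two (hE i) (hE j) x)).trans ?_
      fin_cases i <;> fin_cases j <;>
        simp [hθ.dual, adaptedCoeff, connP, connQ, connA, connB] <;> ring
    · refine (congrArg Neg.neg (hs.dOne_three (hE i) (hE j) x)).trans ?_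
      fin_cases i <;> fin_cases j <;>
        simp [hθ.dual, adaptedCoeff, connP, connQ, connA, connB] <;> ring
    · refine (congrArg Neg.neg (hs.dOne_four (hE i) (hE j) x)).trans ?_
      fin_cases i <;> fin_cases j <;>
        simp [hθ.dual, adaptedCoeff, connP, connQ, connA, connB] <;> ring

end StructureEquations

end Adapted

/-! ### The curvature of an adapted frame -/

section Curvature

variable {M : Type*} [TopologicalSpace M] [ChartedSpace (EuclideanSpace ℝ (Fin 4)) M]
  [IsManifold (𝓡 4) ∞ M]

/-- A coframe `θ` with dual frame `E` satisfying the structure equations for smooth, nowhere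
vanishing functions `a` and `b`. -/
structure IsAdapted (θ : Fin 4 → OneForm M) (E : Fin 4 → VField M) (a b : M → ℝ) : Prop where
  coframe : IsDualCoframe θ E
  smooth_fst : SmoothFun a
  smooth_snd : SmoothFun b
  fst_ne : ∀ x, a x ≠ 0
  snd_ne : ∀ x, b x ≠ 0
  struct : StructureEquations θ E a b

omit [IsManifold (𝓡 4) ∞ M] in
theorem wedge_apply (σ τ : OneForm M) (x : M) (u v : TangentSpace (𝓡 4) x) :
    wedge σ τ x u v = σ x u * τ x v - τ x u * σ x v :=
  rfl

variable {θ : Fin 4 → OneForm M} {E : Fin 4 → VField M} {a b : M → ℝ}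

namespace IsAdapted

theorem conn (h : IsAdapted θ E a b) : IsConnectionCoeff θ E (adaptedCoeff E a b) :=
  h.struct.isConnectionCoeff h.coframe h.smooth_fst h.smooth_snd h.fst_ne h.snd_ne

theorem dirD_fst (h : IsAdapted θ E a b) (X : VField M) (x : M) :
    dirD X a x = a x * logD X a x :=
  dirD_eq_mul_logD X (h.smooth_fst.diffAt x) (h.fst_ne x)

theorem dirD_snd (h : IsAdapted θ E a b) (X : VField M) (x : M) :
    dirD X b x = b x * logD X b x :=
  dirD_eq_mul_logD X (h.smooth_snd.diffAt x) (h.snd_ne x)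

/-- The curvature components `g(R(E_i, E_j) E_k, E_l)` of an adapted frame. -/
noncomputable def curv (_ : IsAdapted θ E a b) (i j k l : Fin 4) (x : M) : ℝ :=
  curvCoeff θ E (adaptedCoeff E a b) i j k l x

theorem curv_two_three (h : IsAdapted θ E a b) (i j : Fin 4) (x : M) :
    h.curv i j 2 3 x = h.curv i j 0 1 x := by
  have e i : adaptedCoeff E a b i 2 3 = adaptedCoeff E a b i 0 1 := rfl
  simp only [curv, curvCoeff, e, Fin.sum_univ_four]
  simp [adaptedCoeff]

theorem curv_one_two (h : IsAdapted θ E a b) (i j : Fin 4) (x : M) :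
    h.curv i j 1 2 x = h.curv i j 0 3 x := by
  have e i : adaptedCoeff E a b i 1 2 = adaptedCoeff E a b i 0 3 := rfl
  simp only [curv, curvCoeff, e, Fin.sum_univ_four]
  simp [adaptedCoeff]
  ring

/-- The forms `ω_01` and `ω_03` involve no derivatives of `a` and `b`, so that the corresponding
curvature components are of first order in `a` and `b`. -/
theorem curv_zero_one (h : IsAdapted θ E a b) (i j : Fin 4) (x : M) :
    h.curv i j 0 1 x = dirD (E i) (connP a b j) x - dirD (E j) (connP a b i) x
      - ∑ m, (adaptedCoeff E a b i j m x - adaptedCoeff E a b j i m x) * connP a b m x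
      - (connQ a b i x * connA E a b j x - connQ a b j x * connA E a b i x)
      - (connB E a b i x * connQ a b j x - connB E a b j x * connQ a b i x) := by
  have e i : adaptedCoeff E a b i 0 1 = connP a b i := rfl
  simp only [curv, curvCoeff, e, h.conn.torsion]
  have r00 i : adaptedCoeff E a b i 0 0 x = 0 := rfl
  have r01 i : adaptedCoeff E a b i 0 1 x = connP a b i x := rfl
  have r11 i : adaptedCoeff E a b i 1 1 x = 0 := rfl
  have r02 i : adaptedCoeff E a b i 0 2 x = connA E a b i x := rfl
  have r21 i : adaptedCoeff E a b i 2 1 x = -connQ a b i x := rfl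
  have r03 i : adaptedCoeff E a b i 0 3 x = connQ a b i x := rfl
  have r31 i : adaptedCoeff E a b i 3 1 x = -connB E a b i x := rfl
  simp only [Fin.sum_univ_four, r00, r01, r11, r02, r21, r03, r31]
  ring

theorem curv_zero_three (h : IsAdapted θ E a b) (i j : Fin 4) (x : M) :
    h.curv i j 0 3 x = dirD (E i) (connQ a b j) x - dirD (E j) (connQ a b i) x
      - ∑ m, (adaptedCoeff E a b i j m x - adaptedCoeff E a b j i m x) * connQ a b m x
      + (connB E a b i x * connP a b j x - connB E a b j x * connP a b i x)
      + (connP a b i x * connA E a b j x - connP a b j x * connA E a b i x) := by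
  have e i : adaptedCoeff E a b i 0 3 = connQ a b i := rfl
  simp only [curv, curvCoeff, e, h.conn.torsion]
  have r00 i : adaptedCoeff E a b i 0 0 x = 0 := rfl
  have r03 i : adaptedCoeff E a b i 0 3 x = connQ a b i x := rfl
  have r01 i : adaptedCoeff E a b i 0 1 x = connP a b i x := rfl
  have r13 i : adaptedCoeff E a b i 1 3 x = connB E a b i x := rfl
  have r02 i : adaptedCoeff E a b i 0 2 x = connA E a b i x := rfl
  have r23 i : adaptedCoeff E a b i 2 3 x = connP a b i x := rfl
  have r33 i : adaptedCoeff E a b i 3 3 x = 0 := rfl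
  simp only [Fin.sum_univ_four, r00, r03, r01, r13, r02, r23, r33]
  ring

theorem dirD_connP (h : IsAdapted θ E a b) (X : VField M) (i : Fin 4) (x : M) :
    dirD X (connP a b i) x
      = ![-(1 / 2) * (b x * logD X b x), 1 / 2 * (a x * logD X a x), 0, 0] i := by
  rw [← h.dirD_fst, ← h.dirD_snd]
  fin_cases i
  exacts [dirD_const_mul X _ (h.smooth_snd.diffAt x), dirD_const_mul X _ (h.smooth_fst.diffAt x),
    dirD_const X 0 x, dirD_const X 0 x]

theorem dirD_connQ (h : IsAdapted θ E a b) (X : VField M) (i : Fin 4) (x : M) :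
    dirD X (connQ a b i) x
      = ![0, 0, 1 / 2 * (b x * logD X b x), 1 / 2 * (a x * logD X a x)] i := by
  rw [← h.dirD_fst, ← h.dirD_snd]
  fin_cases i
  exacts [dirD_const X 0 x, dirD_const X 0 x, dirD_const_mul X _ (h.smooth_snd.diffAt x),
    dirD_const_mul X _ (h.smooth_fst.diffAt x)]

theorem curv_skew (h : IsAdapted θ E a b) (i j k l : Fin 4) (x : M) :
    h.curv i j l k x = -h.curv i j k l x := h.conn.curvCoeff_skew i j k l x

theorem curv_swap (h : IsAdapted θ E a b) (i j k l : Fin 4) (x : M) :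
    h.curv j i k l x = -h.curv i j k l x := IsConnectionCoeff.curvCoeff_swap i j k l x

theorem curv_bianchi (h : IsAdapted θ E a b) (i j k l : Fin 4) (x : M) :
    h.curv i j k l x + h.curv j k i l x + h.curv k i j l x = 0 :=
  h.conn.bianchi h.coframe i j k l x

/-- The integrability condition `E_2 a = E_3 b`. It is the symmetry
`R(E_0, E_1, E_0, E_3) = R(E_0, E_3, E_0, E_1)`, both sides being of first order in `a` and `b`. -/
theorem compat (h : IsAdapted θ E a b) (x : M) :
    a x * logD (E 2) a x = b x * logD (E 3) b x := by
  have e1 : h.curv 0 1 0 3 x = 1 / 2 * (a x * logD (E 2) a x - b x * logD (E 3) b x) := by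
    rw [h.curv_zero_three, h.dirD_connQ, h.dirD_connQ]
    simp [Fin.sum_univ_four, adaptedCoeff, connP, connQ, connA, connB]
    ring
  have e2 : h.curv 0 3 0 1 x = -(1 / 2) * (a x * logD (E 2) a x - b x * logD (E 3) b x) := by
    rw [h.curv_zero_one, h.dirD_connP, h.dirD_connP]
    simp [Fin.sum_univ_four, adaptedCoeff, connP, connQ, connA, connB]
    ring
  have e3 := h.curv_skew 0 1 0 3 x
  have e4 := h.curv_skew 3 0 0 1 x
  have e5 := h.curv_swap 0 3 0 1 x
  have e6 := h.curv_skew 1 3 0 0 x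
  have e7 := h.curv_bianchi 0 1 3 0 x
  linarith

/-- The function `μ = (E_0 a + E_1 b) / 2 + (a² + b²) / 4`, the component
`g(R(E_0, E_1) E_0, E_1)` of the curvature. -/
noncomputable def curvMu (_ : IsAdapted θ E a b) (x : M) : ℝ :=
  1 / 2 * (a x * logD (E 0) a x + b x * logD (E 1) b x) + 1 / 4 * (a x ^ 2 + b x ^ 2)

theorem curv_zero_one_table (h : IsAdapted θ E a b) (x : M) :
    h.curv 0 1 0 1 x = h.curvMu x ∧ h.curv 0 2 0 1 x = 0 ∧
    h.curv 0 3 0 1 x = 0 ∧ h.curv 1 2 0 1 x = 0 ∧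
    h.curv 1 3 0 1 x = 0 ∧ h.curv 2 3 0 1 x = h.curvMu x := by
  have hc := h.compat x
  refine ⟨?_, ?_, ?_, ?_, ?_, ?_⟩ <;>
    rw [h.curv_zero_one, h.dirD_connP, h.dirD_connP] <;>
    simp [Fin.sum_univ_four, adaptedCoeff, connP, connQ, connA, connB, curvMu] <;>
    linarith

theorem curv_zero_three_table (h : IsAdapted θ E a b) (x : M) :
    h.curv 0 1 0 3 x = 0 ∧ h.curv 0 2 0 3 x = 0 ∧
    h.curv 0 3 0 3 x = h.curvMu x ∧ h.curv 1 2 0 3 x = h.curvMu x ∧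
    h.curv 1 3 0 3 x = 0 ∧ h.curv 2 3 0 3 x = 0 := by
  have hc := h.compat x
  refine ⟨?_, ?_, ?_, ?_, ?_, ?_⟩ <;>
    rw [h.curv_zero_three, h.dirD_connQ, h.dirD_connQ] <;>
    simp [Fin.sum_univ_four, adaptedCoeff, connP, connQ, connA, connB, curvMu] <;>
    linarith

/-- The components of `Ω_02` other than `R(E_0, E_2, E_0, E_2)` are derived from those of `Ω_01` and
`Ω_03` by the first Bianchi identity. -/
theorem curv_zero_two_table (h : IsAdapted θ E a b) (x : M) :
    h.curv 0 1 0 2 x = 0 ∧ h.curv 0 3 0 2 x = 0 ∧ h.curv 1 2 0 2 x = 0 ∧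
    h.curv 1 3 0 2 x = 2 * h.curvMu x ∧ h.curv 2 3 0 2 x = 0 := by
  obtain ⟨p01, p02, p03, p12, p13, p23⟩ := h.curv_zero_one_table x
  obtain ⟨q01, q02, q03, q12, q13, q23⟩ := h.curv_zero_three_table x
  have hz i j k : h.curv i j k k x = 0 := by linarith [h.curv_skew i j k k x]
  refine ⟨?_, ?_, ?_, ?_, ?_⟩
  · linarith [h.curv_bianchi 0 1 2 0 x, hz 1 2 0, h.curv_skew 2 0 0 1 x, h.curv_swap 0 2 0 1 x,
      h.curv_skew 0 1 0 2 x]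
  · linarith [h.curv_bianchi 0 3 2 0 x, hz 3 2 0, h.curv_skew 2 0 0 3 x, h.curv_swap 0 2 0 3 x,
      h.curv_skew 0 3 0 2 x]
  · linarith [h.curv_bianchi 1 2 0 2 x, hz 0 1 2, h.curv_one_two 2 0 x, h.curv_swap 0 2 0 3 x]
  · linarith [h.curv_bianchi 1 3 0 2 x, h.curv_one_two 3 0 x, h.curv_swap 0 3 0 3 x,
      h.curv_skew 0 1 2 3 x, h.curv_two_three 0 1 x]
  · linarith [h.curv_bianchi 2 3 0 2 x, hz 3 0 2, h.curv_skew 0 2 2 3 x, h.curv_two_three 0 2 x]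

theorem curv_one_three_table (h : IsAdapted θ E a b) (x : M) :
    h.curv 0 1 1 3 x = 0 ∧ h.curv 0 2 1 3 x = 2 * h.curvMu x ∧ h.curv 0 3 1 3 x = 0 ∧
    h.curv 1 2 1 3 x = 0 ∧ h.curv 2 3 1 3 x = 0 := by
  obtain ⟨p01, p02, p03, p12, p13, p23⟩ := h.curv_zero_one_table x
  obtain ⟨q01, q02, q03, q12, q13, q23⟩ := h.curv_zero_three_table x
  have hz i j k : h.curv i j k k x = 0 := by linarith [h.curv_skew i j k k x]
  refine ⟨?_, ?_, ?_, ?_, ?_⟩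
  · linarith [h.curv_bianchi 0 1 3 1 x, hz 3 0 1, h.curv_skew 0 1 1 3 x]
  · linarith [h.curv_bianchi 0 2 1 3 x, h.curv_swap 1 2 0 3 x, h.curv_two_three 1 0 x,
      h.curv_swap 0 1 0 1 x]
  · linarith [h.curv_bianchi 0 3 1 3 x, hz 1 0 3, h.curv_swap 1 3 0 3 x]
  · linarith [h.curv_bianchi 1 2 3 1 x, hz 2 3 1, h.curv_skew 3 1 1 2 x, h.curv_one_two 3 1 x,
      h.curv_swap 1 3 0 3 x, h.curv_skew 1 2 1 3 x]
  · linarith [h.curv_bianchi 2 3 1 3 x, hz 1 2 3, h.curv_two_three 3 1 x, h.curv_swap 1 3 0 1 x]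

/-- The curvature form `Ω_01 = Ω_23`, see `curvP_eq`. -/
noncomputable def curvP (h : IsAdapted θ E a b) (x : M) (u v : TangentSpace (𝓡 4) x) : ℝ :=
  h.curvMu x * (wedge (θ 0) (θ 1) x u v + wedge (θ 2) (θ 3) x u v)

/-- The curvature form `Ω_03 = Ω_12`, see `curvQ_eq`. -/
noncomputable def curvQ (h : IsAdapted θ E a b) (x : M) (u v : TangentSpace (𝓡 4) x) : ℝ :=
  h.curvMu x * (wedge (θ 0) (θ 3) x u v + wedge (θ 1) (θ 2) x u v)

/-- The curvature form `Ω_02`, see `curvA_eq`. -/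
noncomputable def curvA (h : IsAdapted θ E a b) (x : M) (u v : TangentSpace (𝓡 4) x) : ℝ :=
  h.curv 0 2 0 2 x * wedge (θ 0) (θ 2) x u v + 2 * h.curvMu x * wedge (θ 1) (θ 3) x u v

/-- The curvature form `Ω_13`, see `curvB_eq`. -/
noncomputable def curvB (h : IsAdapted θ E a b) (x : M) (u v : TangentSpace (𝓡 4) x) : ℝ :=
  2 * h.curvMu x * wedge (θ 0) (θ 2) x u v + h.curv 1 3 1 3 x * wedge (θ 1) (θ 3) x u v

theorem curvP_eq (h : IsAdapted θ E a b) (x : M) (u v : TangentSpace (𝓡 4) x) :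
    ∑ i, ∑ j, θ i x u * θ j x v * h.curv i j 0 1 x = h.curvP x u v := by
  obtain ⟨p1, p2, p3, p4, p5, p6⟩ := h.curv_zero_one_table x
  have hd i : h.curv i i 0 1 x = 0 := by linarith [h.curv_swap i i 0 1 x]
  have hs i j := h.curv_swap i j 0 1 x
  rw [curvP, wedge_apply, wedge_apply]
  simp only [Fin.sum_univ_four, hd, hs 0 1, hs 0 2, hs 0 3, hs 1 2, hs 1 3, hs 2 3, p1, p2,
    p3, p4, p5, p6]
  ring

theorem curvQ_eq (h : IsAdapted θ E a b) (x : M) (u v : TangentSpace (𝓡 4) x) :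
    ∑ i, ∑ j, θ i x u * θ j x v * h.curv i j 0 3 x = h.curvQ x u v := by
  obtain ⟨p1, p2, p3, p4, p5, p6⟩ := h.curv_zero_three_table x
  have hd i : h.curv i i 0 3 x = 0 := by linarith [h.curv_swap i i 0 3 x]
  have hs i j := h.curv_swap i j 0 3 x
  rw [curvQ, wedge_apply, wedge_apply]
  simp only [Fin.sum_univ_four, hd, hs 0 1, hs 0 2, hs 0 3, hs 1 2, hs 1 3, hs 2 3, p1, p2,
    p3, p4, p5, p6]
  ring

theorem curvA_eq (h : IsAdapted θ E a b) (x : M) (u v : TangentSpace (𝓡 4) x) :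
    ∑ i, ∑ j, θ i x u * θ j x v * h.curv i j 0 2 x = h.curvA x u v := by
  obtain ⟨p1, p2, p3, p4, p5⟩ := h.curv_zero_two_table x
  have hd i : h.curv i i 0 2 x = 0 := by linarith [h.curv_swap i i 0 2 x]
  have hs i j := h.curv_swap i j 0 2 x
  rw [curvA, wedge_apply, wedge_apply]
  simp only [Fin.sum_univ_four, hd, hs 0 1, hs 0 2, hs 0 3, hs 1 2, hs 1 3, hs 2 3, p1, p2,
    p3, p4, p5]
  ring

theorem curvB_eq (h : IsAdapted θ E a b) (x : M) (u v : TangentSpace (𝓡 4) x) :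
    ∑ i, ∑ j, θ i x u * θ j x v * h.curv i j 1 3 x = h.curvB x u v := by
  obtain ⟨p1, p2, p3, p4, p5⟩ := h.curv_one_three_table x
  have hd i : h.curv i i 1 3 x = 0 := by linarith [h.curv_swap i i 1 3 x]
  have hs i j := h.curv_swap i j 1 3 x
  rw [curvB, wedge_apply, wedge_apply]
  simp only [Fin.sum_univ_four, hd, hs 0 1, hs 0 2, hs 0 3, hs 1 2, hs 1 3, hs 2 3, p1, p2,
    p3, p4, p5]
  ring

/-- The curvature operator `R(u, v)`, which takes values in `u(2)`. -/
theorem curvature_eq (h : IsAdapted θ E a b) {R : CurvField M}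
    (hR : IsRiemannCurvature h.coframe.metric R) (x : M) (u v w : TangentSpace (𝓡 4) x) :
    θ 0 x (R x u v w)
        = -(θ 1 x w * h.curvP x u v + θ 2 x w * h.curvA x u v + θ 3 x w * h.curvQ x u v) ∧
      θ 1 x (R x u v w)
        = θ 0 x w * h.curvP x u v - θ 2 x w * h.curvQ x u v - θ 3 x w * h.curvB x u v ∧
      θ 2 x (R x u v w)
        = θ 0 x w * h.curvA x u v + θ 1 x w * h.curvQ x u v - θ 3 x w * h.curvP x u v ∧
      θ 3 x (R x u v w)
        = θ 0 x w * h.curvQ x u v + θ 1 x w * h.curvB x u v + θ 2 x w * h.curvP x u v := by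
  have hc l : θ l x (R x u v w)
      = ∑ k, θ k x w * ∑ i, ∑ j, θ i x u * θ j x v * h.curv i j k l x := by
    rw [h.conn.eq_curvTensor h.coframe hR]
    exact IsConnectionCoeff.curvTensor_coeff h.coframe x u v w l
  have hsum k l : ∑ i, ∑ j, θ i x u * θ j x v * h.curv i j l k x
      = -∑ i, ∑ j, θ i x u * θ j x v * h.curv i j k l x := by
    simp only [h.curv_skew _ _ k l, mul_neg, Finset.sum_neg_distrib]
  have hd k : ∑ i, ∑ j, θ i x u * θ j x v * h.curv i j k k x = 0 := by
    linarith [hsum k k]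
  have h12 : ∑ i, ∑ j, θ i x u * θ j x v * h.curv i j 1 2 x = h.curvQ x u v := by
    simp only [h.curv_one_two, h.curvQ_eq]
  have h23 : ∑ i, ∑ j, θ i x u * θ j x v * h.curv i j 2 3 x = h.curvP x u v := by
    simp only [h.curv_two_three, h.curvP_eq]
  have hc' l := (hc l).trans (Fin.sum_univ_four _)
  rw [hc', hc', hc', hc']
  rw [hd, hd, hd, hd, hsum 0 1, hsum 0 2, hsum 0 3, hsum 1 2, hsum 1 3, hsum 2 3, h12, h23,
    h.curvP_eq, h.curvQ_eq, h.curvA_eq, h.curvB_eq]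
  refine ⟨?_, ?_, ?_, ?_⟩ <;> ring

end IsAdapted
end Curvature

/-! ### The two complex structures and the Lee form -/

section ComplexStructures

variable {M : Type*} [TopologicalSpace M] [ChartedSpace (EuclideanSpace ℝ (Fin 4)) M]
  [IsManifold (𝓡 4) ∞ M]

/-- The endomorphism field with `E_0 ↦ s E_2`, `E_2 ↦ -s E_0`, `E_1 ↦ E_3`, `E_3 ↦ -E_1`. It is the
complex structure `J` for `s = 1` and the opposite structure `I` for `s = -1`. -/
noncomputable def frameCplx (θ : Fin 4 → OneForm M) (E : Fin 4 → VField M) (s : ℝ) : EndField M :=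
  fun x => s • ((θ 0 x).smulRight (E 2 x) - (θ 2 x).smulRight (E 0 x))
    + ((θ 1 x).smulRight (E 3 x) - (θ 3 x).smulRight (E 1 x))

variable {θ : Fin 4 → OneForm M} {E : Fin 4 → VField M} {a b : M → ℝ}

namespace IsDualCoframe

theorem frameCplx_coeff (hθ : IsDualCoframe θ E) (s : ℝ) (x : M) (v : TangentSpace (𝓡 4) x)
    (k : Fin 4) : θ k x (frameCplx θ E s x v)
      = ![-s * θ 2 x v, -θ 3 x v, s * θ 0 x v, θ 1 x v] k := by
  have e : frameCplx θ E s x v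
      = s • (θ 0 x v • E 2 x - θ 2 x v • E 0 x) + (θ 1 x v • E 3 x - θ 3 x v • E 1 x) := rfl
  rw [e]
  fin_cases k <;> simp [hθ.dual]

theorem frameCplx_zero (hθ : IsDualCoframe θ E) (s : ℝ) (x : M) (v : TangentSpace (𝓡 4) x) :
    θ 0 x (frameCplx θ E s x v) = -s * θ 2 x v := hθ.frameCplx_coeff s x v 0

theorem frameCplx_one (hθ : IsDualCoframe θ E) (s : ℝ) (x : M) (v : TangentSpace (𝓡 4) x) :
    θ 1 x (frameCplx θ E s x v) = -θ 3 x v := hθ.frameCplx_coeff s x v 1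

theorem frameCplx_two (hθ : IsDualCoframe θ E) (s : ℝ) (x : M) (v : TangentSpace (𝓡 4) x) :
    θ 2 x (frameCplx θ E s x v) = s * θ 0 x v := hθ.frameCplx_coeff s x v 2

theorem frameCplx_three (hθ : IsDualCoframe θ E) (s : ℝ) (x : M) (v : TangentSpace (𝓡 4) x) :
    θ 3 x (frameCplx θ E s x v) = θ 1 x v := hθ.frameCplx_coeff s x v 3

theorem ext_four (hθ : IsDualCoframe θ E) {x : M} {u v : TangentSpace (𝓡 4) x}
    (h0 : θ 0 x u = θ 0 x v) (h1 : θ 1 x u = θ 1 x v) (h2 : θ 2 x u = θ 2 x v)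
    (h3 : θ 3 x u = θ 3 x v) : u = v := by
  refine hθ.ext fun k => ?_
  fin_cases k
  exacts [h0, h1, h2, h3]

theorem smooth_frameCplx (hθ : IsDualCoframe θ E) (s : ℝ) {X : VField M} (hX : SmoothField X) :
    SmoothField fun x => frameCplx θ E s x (X x) := by
  have hc := hθ.smooth_coeff hX
  refine hθ.smooth_of_coeff fun k => ?_
  fin_cases k
  · exact ((SmoothFun.const (-s)).mul (hc 2)).congr fun y => hθ.frameCplx_zero s y _
  · exact (hc 3).neg.congr fun y => hθ.frameCplx_one s y _
  · exact ((SmoothFun.const s).mul (hc 0)).congr fun y => hθ.frameCplx_two s y _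
  · exact (hc 1).congr fun y => hθ.frameCplx_three s y _

theorem fundamentalForm_apply (hθ : IsDualCoframe θ E) (s : ℝ) (x : M)
    (u v : TangentSpace (𝓡 4) x) :
    fundamentalForm hθ.metric (frameCplx θ E s) x u v
      = s * (θ 0 x u * θ 2 x v - θ 2 x u * θ 0 x v)
        + (θ 1 x u * θ 3 x v - θ 3 x u * θ 1 x v) := by
  change hθ.metric.inner x (frameCplx θ E s x u) v = _
  rw [hθ.metric_apply, Fin.sum_univ_four, hθ.frameCplx_zero, hθ.frameCplx_one, hθ.frameCplx_two,
    hθ.frameCplx_three]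
  ring

end IsDualCoframe

omit [IsManifold (𝓡 4) ∞ M] in
theorem apply_bracket (τ : OneForm M) (X Y : VField M) (x : M) :
    τ x (VectorField.mlieBracket (𝓡 4) X Y x)
      = dirD X (fun y => τ y (Y y)) x - dirD Y (fun y => τ y (X y)) x - dOne τ X Y x := by
  unfold dOne
  ring

namespace IsAdapted

theorem isHermitian (h : IsAdapted θ E a b) {s : ℝ} (hs : s = 1 ∨ s = -1) :
    IsHermitian h.coframe.metric (frameCplx θ E s) where
  smooth _ hX := h.coframe.smooth_frameCplx s hX
  sq x v := by
    have hθ := h.coframe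
    have hss : s * s = 1 := by rcases hs with rfl | rfl <;> norm_num
    apply hθ.ext_four <;>
      simp only [hθ.frameCplx_zero, hθ.frameCplx_one, hθ.frameCplx_two, hθ.frameCplx_three,
        map_neg]
    · linear_combination (-θ 0 x v) * hss
    · linear_combination (-θ 2 x v) * hss
  orthogonal x u v := by
    have hθ := h.coframe
    have hss : s * s = 1 := by rcases hs with rfl | rfl <;> norm_num
    rw [hθ.metric_apply, hθ.metric_apply]
    simp only [Fin.sum_univ_four, hθ.frameCplx_zero, hθ.frameCplx_one, hθ.frameCplx_two,
      hθ.frameCplx_three]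
    linear_combination (θ 0 x u * θ 0 x v + θ 2 x u * θ 2 x v) * hss
  nijenhuis X Y hX hY x := by
    have hθ := h.coframe
    have hKX := hθ.smooth_frameCplx s hX
    have hKY := hθ.smooth_frameCplx s hY
    have dX k := (hθ.smooth_coeff hX k).diffAt x
    have dY k := (hθ.smooth_coeff hY k).diffAt x
    have cX U r k := dirD_const_mul U r (dX k)
    have cY U r k := dirD_const_mul U r (dY k)
    -- the derivatives of the components of `X` and `Y` cancel, and only terms from `dθ_k` remain
    apply hθ.ext_four <;>
      simp only [map_sub, map_zero, hθ.frameCplx_zero, hθ.frameCplx_one, hθ.frameCplx_two,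
        hθ.frameCplx_three, apply_bracket, h.struct.dOne_one hX hY, h.struct.dOne_one hKX hY,
        h.struct.dOne_one hX hKY, h.struct.dOne_one hKX hKY, h.struct.dOne_two hX hY,
        h.struct.dOne_two hKX hY, h.struct.dOne_two hX hKY, h.struct.dOne_two hKX hKY,
        h.struct.dOne_three hX hY, h.struct.dOne_three hKX hY, h.struct.dOne_three hX hKY,
        h.struct.dOne_three hKX hKY, h.struct.dOne_four hX hY, h.struct.dOne_four hKX hY,
        h.struct.dOne_four hX hKY, h.struct.dOne_four hKX hKY, dirD_neg, cX, cY] <;>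
      rcases hs with rfl | rfl <;> ring

/-- The 1-form `a θ_0 + b θ_1`, which turns out to be the Lee form of `I`. -/
noncomputable def leeForm (_ : IsAdapted θ E a b) : OneForm M :=
  fun x => a x • θ 0 x + b x • θ 1 x

theorem leeForm_apply (h : IsAdapted θ E a b) (x : M) (v : TangentSpace (𝓡 4) x) :
    h.leeForm x v = a x * θ 0 x v + b x * θ 1 x v :=
  rfl

/-- The factor `1 - s` combines the two cases `dω_J = 0` and `dω_I = 2 (a θ_0 + b θ_1) ∧ ω_I`. -/
theorem dTwo_fundamentalForm (h : IsAdapted θ E a b) {s : ℝ} (hs : s = 1 ∨ s = -1)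
    {X Y Z : VField M} (hX : SmoothField X) (hY : SmoothField Y) (hZ : SmoothField Z) (x : M) :
    dTwo (fundamentalForm h.coframe.metric (frameCplx θ E s)) X Y Z x
      = (1 - s) * wedgeTwo h.leeForm (fundamentalForm h.coframe.metric (frameCplx θ E s)) x
          (X x) (Y x) (Z x) := by
  have hθ := h.coframe
  have key (U : VField M) {V W : VField M} (hV : SmoothField V) (hW : SmoothField W) :
      dirD U (fun y => fundamentalForm hθ.metric (frameCplx θ E s) y (V y) (W y)) x
        = s * (θ 0 x (V x) * dirD U (fun y => θ 2 y (W y)) x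
            + dirD U (fun y => θ 0 y (V y)) x * θ 2 x (W x)
            - (θ 2 x (V x) * dirD U (fun y => θ 0 y (W y)) x
            + dirD U (fun y => θ 2 y (V y)) x * θ 0 x (W x)))
          + (θ 1 x (V x) * dirD U (fun y => θ 3 y (W y)) x
            + dirD U (fun y => θ 1 y (V y)) x * θ 3 x (W x)
            - (θ 3 x (V x) * dirD U (fun y => θ 1 y (W y)) x
            + dirD U (fun y => θ 3 y (V y)) x * θ 1 x (W x))) := by
    have cV := hθ.smooth_coeff hV
    have cW := hθ.smooth_coeff hW
    have m k l := dirD_mul U ((cV k).diffAt x) ((cW l).diffAt x)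
    have d k l := (cV k).mul (cW l)
    simp only [hθ.fundamentalForm_apply]
    rw [dirD_add U (((SmoothFun.const s).mul ((d 0 2).sub (d 2 0))).diffAt x)
      (((d 1 3).sub (d 3 1)).diffAt x), dirD_const_mul U s (((d 0 2).sub (d 2 0)).diffAt x),
      dirD_sub U ((d 0 2).diffAt x) ((d 2 0).diffAt x),
      dirD_sub U ((d 1 3).diffAt x) ((d 3 1).diffAt x), m, m, m, m]
  unfold dTwo wedgeTwo
  rw [key X hY hZ, key Y hZ hX, key Z hX hY]
  simp only [hθ.fundamentalForm_apply, h.leeForm_apply, apply_bracket, h.struct.dOne_one hX hY,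
    h.struct.dOne_one hY hZ, h.struct.dOne_one hZ hX, h.struct.dOne_two hX hY,
    h.struct.dOne_two hY hZ, h.struct.dOne_two hZ hX, h.struct.dOne_three hX hY,
    h.struct.dOne_three hY hZ, h.struct.dOne_three hZ hX, h.struct.dOne_four hX hY,
    h.struct.dOne_four hY hZ, h.struct.dOne_four hZ hX]
  rcases hs with rfl | rfl <;> ring

theorem isKahler (h : IsAdapted θ E a b) : IsKahler h.coframe.metric (frameCplx θ E 1) where
  hermitian := h.isHermitian (Or.inl rfl)
  closed X Y Z hX hY hZ x := by
    rw [h.dTwo_fundamentalForm (Or.inl rfl) hX hY hZ, sub_self, zero_mul]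

theorem smooth_leeForm (h : IsAdapted θ E a b) : SmoothOneForm h.leeForm :=
  (SmoothOneForm.smul h.smooth_fst (h.coframe.smooth_coframe 0)).add
    (SmoothOneForm.smul h.smooth_snd (h.coframe.smooth_coframe 1))

theorem isLeeForm (h : IsAdapted θ E a b) :
    IsLeeForm h.coframe.metric (frameCplx θ E (-1)) h.leeForm where
  smooth := h.smooth_leeForm
  eq X Y Z hX hY hZ x := by
    rw [h.dTwo_fundamentalForm (Or.inr rfl) hX hY hZ]
    norm_num

/-- The Lee form is unique, because the wedge product with the nondegenerate form `ω_I` is injective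
on 1-forms. -/
theorem eq_leeForm (h : IsAdapted θ E a b) {lee : OneForm M}
    (hl : IsLeeForm h.coframe.metric (frameCplx θ E (-1)) lee) : lee = h.leeForm := by
  have hθ := h.coframe
  have hE := hθ.smooth_frame
  funext x
  have key i j k := (hl.eq _ _ _ (hE i) (hE j) (hE k) x).symm.trans
    (h.isLeeForm.eq _ _ _ (hE i) (hE j) (hE k) x)
  -- the triple with first index `k` isolates the coefficient of `θ_k`
  have e0 := key 0 1 3
  have e1 := key 1 0 2
  have e2 := key 2 1 3
  have e3 := key 3 0 2
  simp only [wedgeTwo, hθ.fundamentalForm_apply] at e0 e1 e2 e3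
  simp [hθ.dual] at e0 e1 e2 e3
  ext v
  rw [hθ.form_expand (lee x), hθ.form_expand (h.leeForm x), Fin.sum_univ_four, Fin.sum_univ_four,
    e0, e1, e2, e3]

/-- Differentiating `a θ_0 + b θ_1` by the structure equations; the derivatives `E_2 a` and `E_3 b`
are equal by `IsAdapted.compat`. -/
theorem dOne_leeForm (h : IsAdapted θ E a b) {X Y : VField M} (hX : SmoothField X)
    (hY : SmoothField Y) (x : M) : dOne h.leeForm X Y x
      = (dirD (E 1) a x - dirD (E 0) b x) * (wedge (θ 1) (θ 0) x (X x) (Y x)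
          + wedge (θ 2) (θ 3) x (X x) (Y x))
        + (dirD (E 3) b x + dirD (E 2) a x) * (wedge (θ 3) (θ 1) x (X x) (Y x)
          + wedge (θ 2) (θ 0) x (X x) (Y x))
        + (dirD (E 2) b x - dirD (E 3) a x) * (wedge (θ 2) (θ 1) x (X x) (Y x)
          + wedge (θ 0) (θ 3) x (X x) (Y x)) := by
  have hθ := h.coframe
  have key (U : VField M) {V : VField M} (hV : SmoothField V) :
      dirD U (fun y => h.leeForm y (V y)) x
        = a x * dirD U (fun y => θ 0 y (V y)) x + dirD U a x * θ 0 x (V x)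
          + (b x * dirD U (fun y => θ 1 y (V y)) x + dirD U b x * θ 1 x (V x)) := by
    have c := hθ.smooth_coeff hV
    simp only [h.leeForm_apply]
    rw [dirD_add U ((h.smooth_fst.mul (c 0)).diffAt x) ((h.smooth_snd.mul (c 1)).diffAt x),
      dirD_mul U (h.smooth_fst.diffAt x) ((c 0).diffAt x),
      dirD_mul U (h.smooth_snd.diffAt x) ((c 1).diffAt x)]
  have hc := h.compat x
  conv_lhs => unfold dOne
  rw [key X hY, key Y hX]
  simp only [h.leeForm_apply, apply_bracket, h.struct.dOne_one hX hY, h.struct.dOne_two hX hY,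
    hθ.dirD_expand X a, hθ.dirD_expand X b, hθ.dirD_expand Y a, hθ.dirD_expand Y b,
    Fin.sum_univ_four, wedge_apply, h.dirD_fst, h.dirD_snd]
  linear_combination (θ 2 x (X x) * θ 0 x (Y x) - θ 0 x (X x) * θ 2 x (Y x)
    - (θ 3 x (X x) * θ 1 x (Y x) - θ 1 x (X x) * θ 3 x (Y x))) * hc

end IsAdapted
end ComplexStructures

/-! ### The Ricci form -/

section Ricci

variable {M : Type*} [TopologicalSpace M] [ChartedSpace (EuclideanSpace ℝ (Fin 4)) M]
  [IsManifold (𝓡 4) ∞ M] {θ : Fin 4 → OneForm M} {E : Fin 4 → VField M} {a b : M → ℝ}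

theorem IsDualCoframe.trace_eq (hθ : IsDualCoframe θ E) (x : M)
    (f : TangentSpace (𝓡 4) x →ₗ[ℝ] TangentSpace (𝓡 4) x) :
    LinearMap.trace ℝ _ f = ∑ i, θ i x (f (E i x)) := by
  let B : Module.Basis (Fin 4) ℝ (TangentSpace (𝓡 4) x) := Module.Basis.ofEquivFun
    { toFun := fun v i => θ i x v
      map_add' := fun u v => funext fun i => map_add _ _ _
      map_smul' := fun c v => funext fun i => map_smul _ _ _
      invFun := fun c => ∑ i, c i • E i x
      left_inv := fun v => hθ.expand v
      right_inv := fun c => funext fun k => hθ.coeff_sum x c k }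
  have hB i : B i = E i x := by
    refine hθ.ext fun k => ?_
    have : θ k x (B i) = B.repr (B i) k := rfl
    rw [this, Module.Basis.repr_self, hθ.dual, Finsupp.single_apply]
    simp [eq_comm]
  rw [LinearMap.trace_eq_matrix_trace ℝ B, Matrix.trace]
  refine Finset.sum_congr rfl fun i _ => ?_
  rw [Matrix.diag_apply, LinearMap.toMatrix_apply, hB]
  rfl

namespace IsAdapted

/-- The Ricci form is `Ω_02 + Ω_13`. -/
theorem ricciForm_eq (h : IsAdapted θ E a b) {R : CurvField M}
    (hR : IsRiemannCurvature h.coframe.metric R) (x : M) (u v : TangentSpace (𝓡 4) x) :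
    ricciForm R (frameCplx θ E 1) x u v = h.curvA x u v + h.curvB x u v := by
  have hθ := h.coframe
  have hc w := h.curvature_eq hR x w u (frameCplx θ E 1 x v)
  rw [ricciForm, ricci, hθ.trace_eq, Fin.sum_univ_four]
  change θ 0 x (R x (E 0 x) u (frameCplx θ E 1 x v)) + θ 1 x (R x (E 1 x) u (frameCplx θ E 1 x v))
    + θ 2 x (R x (E 2 x) u (frameCplx θ E 1 x v)) + θ 3 x (R x (E 3 x) u (frameCplx θ E 1 x v)) = _
  rw [(hc (E 0 x)).1, (hc (E 1 x)).2.1, (hc (E 2 x)).2.2.1, (hc (E 3 x)).2.2.2]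
  simp only [curvA, curvB, curvP, curvQ, wedge_apply, hθ.frameCplx_zero, hθ.frameCplx_one,
    hθ.frameCplx_two, hθ.frameCplx_three]
  simp [hθ.dual]
  ring

theorem ricciForm_frameCplx (h : IsAdapted θ E a b) {R : CurvField M}
    (hR : IsRiemannCurvature h.coframe.metric R) {s : ℝ} (hs : s = 1 ∨ s = -1) (x : M)
    (u v : TangentSpace (𝓡 4) x) :
    ricciForm R (frameCplx θ E 1) x (frameCplx θ E s x u) (frameCplx θ E s x v)
      = ricciForm R (frameCplx θ E 1) x u v := by
  have hθ := h.coframe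
  rw [h.ricciForm_eq hR, h.ricciForm_eq hR]
  simp only [curvA, curvB, wedge_apply, hθ.frameCplx_zero, hθ.frameCplx_one,
    hθ.frameCplx_two, hθ.frameCplx_three]
  rcases hs with rfl | rfl <;> ring

/-- The connection form `ω_02 + ω_13` on the canonical bundle is `d^I (ln |b| - ln |a|)`. -/
theorem dTwist_log (h : IsAdapted θ E a b) :
    dTwist (frameCplx θ E (-1)) (fun y => Real.log |b y| - Real.log |a y|)
      = fun x => connForm θ (adaptedCoeff E a b) 0 2 x + connForm θ (adaptedCoeff E a b) 1 3 x := by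
  have hθ := h.coframe
  funext x
  ext v
  have la := (h.smooth_fst.log_abs h.fst_ne).diffAt x
  have lb := (h.smooth_snd.log_abs h.snd_ne).diffAt x
  have hr i : mvfderiv (𝓡 4) (fun y => Real.log |b y| - Real.log |a y|) x (E i x)
      = logD (E i) b x - logD (E i) a x := dirD_sub (E i) lb la
  change -mvfderiv (𝓡 4) (fun y => Real.log |b y| - Real.log |a y|) x (frameCplx θ E (-1) x v)
    = connForm θ (adaptedCoeff E a b) 0 2 x v + connForm θ (adaptedCoeff E a b) 1 3 x v
  rw [hθ.form_expand (mvfderiv (𝓡 4) _ x), connForm_apply, connForm_apply]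
  simp only [hr, Fin.sum_univ_four, hθ.frameCplx_zero, hθ.frameCplx_one, hθ.frameCplx_two,
    hθ.frameCplx_three]
  simp [adaptedCoeff, connA, connB]
  ring

/-- The Ricci form `Ω_02 + Ω_13` is `d (ω_02 + ω_13)`: the quadratic terms of Cartan's second
structure equation cancel in the sum. -/
theorem ricciForm_eq_dOne (h : IsAdapted θ E a b) {R : CurvField M}
    (hR : IsRiemannCurvature h.coframe.metric R) {X Y : VField M} (hX : SmoothField X)
    (hY : SmoothField Y) (x : M) :
    ricciForm R (frameCplx θ E 1) x (X x) (Y x)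
      = dOne (dTwist (frameCplx θ E (-1)) fun y => Real.log |b y| - Real.log |a y|) X Y x := by
  have hθ := h.coframe
  have hA := (h.conn.dOne_connForm_add hθ 0 2 hX hY x).trans (h.curvA_eq x (X x) (Y x))
  have hB := (h.conn.dOne_connForm_add hθ 1 3 hX hY x).trans (h.curvB_eq x (X x) (Y x))
  have s1 := h.conn.smooth_connForm hθ 0 2
  have s2 := h.conn.smooth_connForm hθ 1 3
  rw [h.ricciForm_eq hR, h.dTwist_log, ← hA, ← hB]
  have hd (U : VField M) {V : VField M} (hV : SmoothField V) :
      dirD U (fun y => (connForm θ (adaptedCoeff E a b) 0 2 y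
        + connForm θ (adaptedCoeff E a b) 1 3 y) (V y)) x
      = dirD U (fun y => connForm θ (adaptedCoeff E a b) 0 2 y (V y)) x
        + dirD U (fun y => connForm θ (adaptedCoeff E a b) 1 3 y (V y)) x :=
    dirD_add U ((s1.apply hV).diffAt x) ((s2.apply hV).diffAt x)
  unfold dOne
  rw [hd X hY, hd Y hX, add_apply]
  have sk j k v := h.conn.connForm_skew j k x v
  have e1 : connForm θ (adaptedCoeff E a b) 2 3 = connForm θ (adaptedCoeff E a b) 0 1 := rfl
  have e2 : connForm θ (adaptedCoeff E a b) 1 2 = connForm θ (adaptedCoeff E a b) 0 3 := rfl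
  have z j v : connForm θ (adaptedCoeff E a b) j j x v = 0 := by linarith [sk j j v]
  simp only [Fin.sum_univ_four, sk 0 1, sk 2 3, e1, e2, z]
  ring

end IsAdapted
end Ricci

/-! ### The distribution and the generalized orthotoric type -/

section Orthotoric

variable {M : Type*} [TopologicalSpace M] [ChartedSpace (EuclideanSpace ℝ (Fin 4)) M]
  [IsManifold (𝓡 4) ∞ M] {θ : Fin 4 → OneForm M} {E : Fin 4 → VField M} {a b : M → ℝ}

/-- The distribution spanned by `E_0` and `E_2`, as the span of a range indexed by `Fin 2` to match
`IsPlaneField`. -/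
noncomputable def framePlane (E : Fin 4 → VField M) : SubspaceField M :=
  fun x => Submodule.span ℝ (Set.range fun i : Fin 2 => (![E 0, E 2] i : VField M) x)

namespace IsDualCoframe

theorem mem_framePlane (hθ : IsDualCoframe θ E) {x : M} {v : TangentSpace (𝓡 4) x} :
    v ∈ framePlane E x ↔ θ 1 x v = 0 ∧ θ 3 x v = 0 := by
  have hr : (Set.range fun i : Fin 2 => (![E 0, E 2] i : VField M) x) = {E 0 x, E 2 x} := by
    ext w
    simp [Fin.exists_fin_two, eq_comm]
  rw [framePlane, hr, Submodule.mem_span_pair]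
  constructor
  · rintro ⟨c, d, rfl⟩
    simp [hθ.dual]
  · rintro ⟨h1, h3⟩
    refine ⟨θ 0 x v, θ 2 x v, hθ.ext_four ?_ ?_ ?_ ?_⟩ <;> simp [hθ.dual, h1, h3]

theorem mem_perp_framePlane (hθ : IsDualCoframe θ E) {x : M} {v : TangentSpace (𝓡 4) x} :
    v ∈ perp hθ.metric (framePlane E) x ↔ θ 0 x v = 0 ∧ θ 2 x v = 0 := by
  constructor
  · intro hv
    have h0 := hv (E 0 x) (hθ.mem_framePlane.2 (by simp [hθ.dual]))
    have h2 := hv (E 2 x) (hθ.mem_framePlane.2 (by simp [hθ.dual]))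
    rw [hθ.metric_apply] at h0 h2
    simpa [hθ.dual] using And.intro h0 h2
  · rintro ⟨h0, h2⟩ w hw
    rw [hθ.mem_framePlane] at hw
    rw [hθ.metric_apply]
    simp [Fin.sum_univ_four, h0, h2, hw.1, hw.2]

theorem isPlaneField_framePlane (hθ : IsDualCoframe θ E) : IsPlaneField (framePlane E) where
  rank x := by
    have hli : LinearIndependent ℝ fun i : Fin 2 => (![E 0, E 2] i : VField M) x := by
      rw [Fintype.linearIndependent_iff]
      intro c hc
      have h0 := congrArg (θ 0 x) hc
      have h2 := congrArg (θ 2 x) hc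
      simp [Fin.sum_univ_two, hθ.dual] at h0 h2
      intro i
      fin_cases i
      exacts [h0, h2]
    rw [framePlane, finrank_span_eq_card hli]
    rfl
  smooth x := by
    refine ⟨Set.univ, isOpen_univ, Set.mem_univ x, ![E 0, E 2], fun i => ?_, fun y _ => rfl⟩
    fin_cases i
    exacts [(hθ.smooth_frame 0).contMDiffOn, (hθ.smooth_frame 2).contMDiffOn]

end IsDualCoframe

namespace IsAdapted

/-- The holomorphic curvature is a function of the lengths of the components of `v` in the two
planes. -/
theorem holomorphic_curvature (h : IsAdapted θ E a b) {R : CurvField M}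
    (hR : IsRiemannCurvature h.coframe.metric R) (x : M) (v : TangentSpace (𝓡 4) x) :
    h.coframe.metric.inner x (R x v (frameCplx θ E 1 x v) (frameCplx θ E 1 x v)) v
      = -(h.curv 0 2 0 2 x * (θ 0 x v ^ 2 + θ 2 x v ^ 2) ^ 2
        + 8 * h.curvMu x * (θ 0 x v ^ 2 + θ 2 x v ^ 2) * (θ 1 x v ^ 2 + θ 3 x v ^ 2)
        + h.curv 1 3 1 3 x * (θ 1 x v ^ 2 + θ 3 x v ^ 2) ^ 2) := by
  have hθ := h.coframe
  obtain ⟨h0, h1, h2, h3⟩ := h.curvature_eq hR x v (frameCplx θ E 1 x v) (frameCplx θ E 1 x v)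
  rw [hθ.metric_apply, Fin.sum_univ_four, h0, h1, h2, h3]
  simp only [curvA, curvB, curvP, curvQ, wedge_apply, hθ.frameCplx_zero, hθ.frameCplx_one,
    hθ.frameCplx_two, hθ.frameCplx_three]
  ring

theorem isQCH (h : IsAdapted θ E a b) :
    IsQCH h.coframe.metric (frameCplx θ E 1) (framePlane E) where
  kahler := h.isKahler
  plane := h.coframe.isPlaneField_framePlane
  invariant x v hv := by
    rw [h.coframe.mem_framePlane] at hv ⊢
    rw [h.coframe.frameCplx_one, h.coframe.frameCplx_three, hv.1, hv.2]
    simp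
  curvature := by
    have hθ := h.coframe
    have hR := h.conn.isRiemannCurvature hθ
    refine ⟨_, hR, ?_⟩
    -- on unit vectors, both lengths are determined by the length of the component in the plane
    have key (x : M) (v v' : TangentSpace (𝓡 4) x) (hv : v ∈ framePlane E x)
        (hv' : v' ∈ perp hθ.metric (framePlane E) x)
        (h1 : hθ.metric.inner x (v + v') (v + v') = 1) :
        θ 0 x (v + v') ^ 2 + θ 2 x (v + v') ^ 2 = hθ.metric.inner x v v ∧
          θ 1 x (v + v') ^ 2 + θ 3 x (v + v') ^ 2 = 1 - hθ.metric.inner x v v := by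
      rw [hθ.mem_framePlane] at hv
      rw [hθ.mem_perp_framePlane] at hv'
      rw [hθ.metric_apply] at h1 ⊢
      simp only [Fin.sum_univ_four, map_add, hv.1, hv.2, hv'.1, hv'.2] at h1 ⊢
      constructor <;> linarith
    intro x v v' w w' hv hw hv' hw' h1 h2 he
    obtain ⟨a1, a2⟩ := key x v v' hv hv' h1
    obtain ⟨b1, b2⟩ := key x w w' hw hw' h2
    rw [h.holomorphic_curvature hR, h.holomorphic_curvature hR, a1, a2, b1, b2, he]

/-- Along a direction in the nullity of `I`, the connection form `ω_01` vanishes, since it does not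
commute with `I`. -/
theorem connForm_eq_zero_of_mem_nullity (h : IsAdapted θ E a b) {x : M}
    {v : TangentSpace (𝓡 4) x}
    (hv : v ∈ nullity (h.coframe.connection (adaptedCoeff E a b)) (frameCplx θ E (-1)) x) :
    connForm θ (adaptedCoeff E a b) 0 1 x v = 0 := by
  have hθ := h.coframe
  have e := congrArg (θ 3 x) (hv (E 0) (hθ.smooth_frame 0))
  rw [hθ.connection_coeff, hθ.frameCplx_three, hθ.connection_coeff] at e
  simp only [hθ.frameCplx_three, hθ.frameCplx_zero, hθ.frameCplx_one, hθ.frameCplx_two,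
    Fin.sum_univ_four, hθ.dual] at e
  have e1 : connForm θ (adaptedCoeff E a b) 2 3 = connForm θ (adaptedCoeff E a b) 0 1 := rfl
  simp [mvfderiv_const, e1] at e
  linarith

theorem isGeneralizedOrthotoric (h : IsAdapted θ E a b) :
    IsGeneralizedOrthotoric h.coframe.metric (frameCplx θ E 1) (frameCplx θ E (-1)) where
  hermitian := h.isHermitian (Or.inr rfl)
  exists_plane := by
    have hθ := h.coframe
    have hE := hθ.smooth_frame
    refine ⟨framePlane E, h.isQCH, ?_, ?_, ?_, ?_, _, h.conn.isLeviCivita hθ, fun x => ?_⟩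
    · intro x v hv
      rw [hθ.mem_framePlane] at hv
      apply hθ.ext_four <;>
        simp [hθ.frameCplx_zero, hθ.frameCplx_one, hθ.frameCplx_two, hθ.frameCplx_three, hv.1, hv.2]
    · intro x v hv
      rw [hθ.mem_perp_framePlane] at hv
      apply hθ.ext_four <;>
        simp [hθ.frameCplx_zero, hθ.frameCplx_one, hθ.frameCplx_two, hθ.frameCplx_three, hv.1, hv.2]
    · rintro U - ⟨x, hx⟩ hi
      have := (hθ.mem_framePlane.1 (hi (E 0) (E 2) (hE 0).contMDiffOn (hE 2).contMDiffOn
        (fun y _ => hθ.mem_framePlane.2 (by simp [hθ.dual]))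
        (fun y _ => hθ.mem_framePlane.2 (by simp [hθ.dual])) x hx)).2
      change structFun θ E 3 0 2 x = 0 at this
      rw [h.conn.torsion] at this
      simp [adaptedCoeff, connP, connQ] at this
      exact h.snd_ne x (by linarith)
    · rintro U - ⟨x, hx⟩ hi
      have := (hθ.mem_perp_framePlane.1 (hi (E 1) (E 3) (hE 1).contMDiffOn (hE 3).contMDiffOn
        (fun y _ => hθ.mem_perp_framePlane.2 (by simp [hθ.dual]))
        (fun y _ => hθ.mem_perp_framePlane.2 (by simp [hθ.dual])) x hx)).2
      change structFun θ E 2 1 3 x = 0 at this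
      rw [h.conn.torsion] at this
      simp [adaptedCoeff, connP, connQ] at this
      exact h.fst_ne x (by linarith)
    · have n0 : E 0 x ∉ nullity (hθ.connection (adaptedCoeff E a b)) (frameCplx θ E (-1)) x := by
        intro hm
        have := h.connForm_eq_zero_of_mem_nullity hm
        simp [connForm_apply, hθ.dual, adaptedCoeff, connP] at this
        exact h.snd_ne x this
      have n1 : E 1 x ∉ nullity (hθ.connection (adaptedCoeff E a b)) (frameCplx θ E (-1)) x := by
        intro hm
        have := h.connForm_eq_zero_of_mem_nullity hm
        simp [connForm_apply, hθ.dual, adaptedCoeff, connP] at this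
        exact h.fst_ne x this
      refine ⟨fun e => n0 (e ▸ Submodule.mem_top), fun e => n0 (e ▸ ?_), fun e => n1 (e ▸ ?_)⟩
      · exact hθ.mem_framePlane.2 (by simp [hθ.dual])
      · exact hθ.mem_perp_framePlane.2 (by simp [hθ.dual])

end IsAdapted
end Orthotoric

theorem theorem2p4 {M : Type*} [TopologicalSpace M] [T2Space M] [SigmaCompactSpace M]
    [ChartedSpace (EuclideanSpace ℝ (Fin 4)) M] [IsManifold (𝓡 4) ∞ M]
    (θ : Fin 4 → OneForm M) (E : Fin 4 → VField M) (hθ : IsDualCoframe θ E)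
    (α φ : M → ℝ)
    (hα : ContMDiff (𝓡 4) 𝓘(ℝ, ℝ) ∞ α) (hφ : ContMDiff (𝓡 4) 𝓘(ℝ, ℝ) ∞ φ)
    (hcos : ∀ x, α x * Real.cos (φ x) ≠ 0) (hsin : ∀ x, α x * Real.sin (φ x) ≠ 0)
    (hstr : StructureEquations θ E
      (fun x => α x * Real.cos (φ x)) (fun x => α x * Real.sin (φ x))) :
    ∃ (g : Metric4 M) (J I : EndField M),
      -- the metric and the two fundamental forms
      (∀ x u v, g.inner x u v = ∑ i, θ i x u * θ i x v) ∧
      (fundamentalForm g J = fun x => wedge (θ 0) (θ 2) x + wedge (θ 1) (θ 3) x) ∧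
      (fundamentalForm g I = fun x => -wedge (θ 0) (θ 2) x + wedge (θ 1) (θ 3) x) ∧
      -- `(M,g,J)` is Kähler, both structures are Hermitian
      IsKahler g J ∧ IsHermitian g J ∧ IsHermitian g I ∧
      -- the Ricci form is `d (d^I ln |tan φ|)` and is invariant under `J` and `I`
      (∃ R : CurvField M, IsRiemannCurvature g R) ∧
      (∀ R : CurvField M, IsRiemannCurvature g R →
        (∀ X Y : VField M, SmoothField X → SmoothField Y → ∀ x,
          ricciForm R J x (X x) (Y x)
            = dOne (dTwist I fun y => Real.log |Real.tan (φ y)|) X Y x) ∧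
        (∀ x u v, ricciForm R J x (J x u) (J x v) = ricciForm R J x u v) ∧
        (∀ x u v, ricciForm R J x (I x u) (I x v) = ricciForm R J x u v)) ∧
      -- QCH of generalized orthotoric type
      IsGeneralizedOrthotoric g J I ∧
      -- the Lee form of `(M,g,I)`
      (∃! lee : OneForm M, IsLeeForm g I lee) ∧
      (∀ lee : OneForm M, IsLeeForm g I lee →
        IsExtDerivOne lee fun x =>
          (dirD (E 1) (fun y => α y * Real.cos (φ y)) x
              - dirD (E 0) (fun y => α y * Real.sin (φ y)) x)
            • (wedge (θ 1) (θ 0) x + wedge (θ 2) (θ 3) x)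
          + (dirD (E 3) (fun y => α y * Real.sin (φ y)) x
              + dirD (E 2) (fun y => α y * Real.cos (φ y)) x)
            • (wedge (θ 3) (θ 1) x + wedge (θ 2) (θ 0) x)
          + (dirD (E 2) (fun y => α y * Real.sin (φ y)) x
              - dirD (E 3) (fun y => α y * Real.cos (φ y)) x)
            • (wedge (θ 2) (θ 1) x + wedge (θ 0) (θ 3) x)) := by
  have h : IsAdapted θ E (fun x => α x * Real.cos (φ x)) (fun x => α x * Real.sin (φ x)) :=
    { coframe := hθ
      smooth_fst := hα.mul (Real.contDiff_cos.contMDiff.comp hφ)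
      smooth_snd := hα.mul (Real.contDiff_sin.contMDiff.comp hφ)
      fst_ne := hcos
      snd_ne := hsin
      struct := hstr }
  have htan : (fun y => Real.log |Real.tan (φ y)|)
      = fun y => Real.log |α y * Real.sin (φ y)| - Real.log |α y * Real.cos (φ y)| := by
    funext y
    have hα0 : α y ≠ 0 := left_ne_zero_of_mul (hcos y)
    rw [Real.tan_eq_sin_div_cos, ← mul_div_mul_left _ _ hα0, abs_div,
      Real.log_div (abs_ne_zero.2 (hsin y)) (abs_ne_zero.2 (hcos y))]
  refine ⟨hθ.metric, frameCplx θ E 1, frameCplx θ E (-1), hθ.metric_apply, ?_, ?_, h.isKahler,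
    h.isHermitian (Or.inl rfl), h.isHermitian (Or.inr rfl), ⟨_, h.conn.isRiemannCurvature hθ⟩,
    fun R hR => ⟨fun X Y hX hY x => ?_, h.ricciForm_frameCplx hR (Or.inl rfl),
      h.ricciForm_frameCplx hR (Or.inr rfl)⟩, h.isGeneralizedOrthotoric,
    ⟨h.leeForm, h.isLeeForm, fun _ hl => h.eq_leeForm hl⟩, fun lee hl X Y hX hY x => ?_⟩
  · funext x
    ext u v
    rw [hθ.fundamentalForm_apply]
    change _ = wedge (θ 0) (θ 2) x u v + wedge (θ 1) (θ 3) x u v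
    rw [one_mul, wedge_apply, wedge_apply]
  · funext x
    ext u v
    rw [hθ.fundamentalForm_apply]
    change _ = -wedge (θ 0) (θ 2) x u v + wedge (θ 1) (θ 3) x u v
    rw [neg_one_mul, wedge_apply, wedge_apply]
  · rw [htan]
    exact h.ricciForm_eq_dOne hR hX hY x
  · obtain rfl := h.eq_leeForm hl
    exact (h.dOne_leeForm hX hY x).symm
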